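/- Let $D$ be an oriented link diagram on the plane $\mathbb{R}^2$, or on the sphere $S^2=\mathbb{R}^2\cup\{\infty\}$ with $\infty\notin D$, with $l$ ordered link components $D_1,\dots,D_l$ (smoothly immersed closed curves whose only singularities are finitely many transverse double points, the crossings, equipped with over/under information) and with at least one crossing. The regions of $D$ are the connected components of the complement of $D$; let $R_\infty$ be the unbounded region (plane) or the region containing $\infty$ (sphere). The set $\mathcal R$ of regions is finite. An Alexander numbering of an oriented diagram is an assignment of integers to its regions such that, for every oriented arc, the number of the region on the left of the arc exceeds that of the region on the right by one; a checkerboard coloring of $D$ is an Alexander numbering of $D$ reduced modulo $2$. For $i=1,\dots,l$ there is exactly one vector $\mathbf u_i\in\mathbb Z^{\mathcal R}$ with $\mathbf u_i(R_\infty)=0$ that arises from an Alexander numbering of the diagram $D_i$ alone by giving each region of $D$ the number of the region of $D_i$ containing it. Let $\mathbf u_\infty\in\mathbb Z^{\mathcal R}$ be the vector with all entries $1$. Checkerboard colorings $c:\mathcal R\to\mathbb Z/2$ of $D$ exist; fix any one, and set $\bar{\mathbf u}_k(R)=(-1)^{c(R)}\,\mathbf u_k(R)$ for $k\in\{1,\dots,l,\infty\}$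 and $R\in\mathcal R$. Let $\Phi_{d2}(D):\mathbb Z^{\mathcal R}\to\mathbb Z^{\{\text{crossings}\}}$ be the homomorphism whose matrix has, for a crossing $x$ and a region $R$, the entry $2$ if $R$ touches $x$ twice (that is, occupies two of the four corners at $x$), the entry $1$ if $x\in\partial R$ but $R$ does not touch $x$ twice, and the entry $0$ otherwise. Then $\bar{\mathbf u}_1,\dots,\bar{\mathbf u}_l,\bar{\mathbf u}_\infty$ form a $\mathbb Z$-basis of the kernel of $\Phi_{d2}(D)$. -/

import Mathlib

open scoped Topology

noncomputable section

/-- Closed curves `γ 0, …, γ (l-1)` are parametrized on `ℝ` with period `1`. A strand is a point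
of the disjoint union of the `l` parameter circles, represented by a parameter in `[0, 1)`. -/
abbrev Strand (l : ℕ) : Type := Fin l × Set.Ico (0 : ℝ) 1

/-- The position in the plane `ℂ = ℝ²` of a strand. -/
def strandPoint {l : ℕ} (γ : Fin l → ℝ → ℂ) (q : Strand l) : ℂ := γ q.1 q.2

/-- The velocity vector of a strand. -/
def strandTangent {l : ℕ} (γ : Fin l → ℝ → ℂ) (q : Strand l) : ℂ := deriv (γ q.1) q.2

/-- The points of the plane passed at least twice by the curves. -/
def multiplePoints {l : ℕ} (γ : Fin l → ℝ → ℂ) : Set ℂ :=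
  {z | ∃ q q' : Strand l, q ≠ q' ∧ strandPoint γ q = z ∧ strandPoint γ q' = z}

/-- An oriented link projection with `l` ordered components: `l` smoothly immersed oriented closed
curves in the plane `ℂ = ℝ²` whose only singularities are finitely many transverse double points.
A projection on the sphere `S² = ℝ² ∪ {∞}` that does not pass through `∞` is the same datum. -/
structure LinkProjection (l : ℕ) where
  curve : Fin l → ℝ → ℂ
  smooth : ∀ i, ContDiff ℝ (⊤ : ℕ∞) (curve i)
  periodic : ∀ i, Function.Periodic (curve i) 1
  immersed : ∀ i t, deriv (curve i) t ≠ 0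
  transverse : ∀ q q' : Strand l, q ≠ q' → strandPoint curve q = strandPoint curve q' →
    LinearIndependent ℝ ![strandTangent curve q, strandTangent curve q']
  double : ∀ q₁ q₂ q₃ : Strand l, strandPoint curve q₁ = strandPoint curve q₂ →
    strandPoint curve q₂ = strandPoint curve q₃ → q₁ = q₂ ∨ q₂ = q₃ ∨ q₁ = q₃
  finite_multiplePoints : (multiplePoints curve).Finite

/-- An oriented link diagram with `l` ordered components: a projection together with the choice,
at every double point, of the strand that passes over. -/
structure LinkDiagram (l : ℕ) extends LinkProjection l where
  overStrand : multiplePoints curve → Strand l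
  overStrand_spec : ∀ x, strandPoint curve (overStrand x) = x

/-- A diagram is drawn on the plane `ℝ²` or on the sphere `S² = ℝ² ∪ {∞}`. -/
inductive Ambient
  | plane
  | sphere

/-- The surface carrying a diagram, as a subset of `S² = ℝ² ∪ {∞}`. -/
def Ambient.carrier : Ambient → Set (OnePoint ℂ)
  | plane => Set.range ((↑) : ℂ → OnePoint ℂ)
  | sphere => Set.univ

namespace LinkProjection

variable {l : ℕ} (P : LinkProjection l) (A : Ambient)

/-- The set of crossings. -/
def crossings : Set ℂ := multiplePoints P.curve

/-- The underlying point set of the projection. -/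
def image : Set ℂ := ⋃ i, Set.range (P.curve i)

/-- The complement of the projection in the plane or the sphere. -/
def complement : Set (OnePoint ℂ) := A.carrier \ ((↑) '' P.image)

/-- The regions: the connected components of the complement of the projection. -/
def Region : Type :=
  {R : Set (OnePoint ℂ) // ∃ x ∈ P.complement A, R = connectedComponentIn (P.complement A) x}

variable {P A}

/-- The points of a region that are different from `∞`. -/
def Region.finitePart (R : P.Region A) : Set ℂ := {z | (z : OnePoint ℂ) ∈ R.1}

/-- `R` is the region `R_∞`: the unbounded region on the plane, the region containing `∞` on the
sphere. -/
def IsRegionAtInfinity : {A : Ambient} → P.Region A → Prop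
  | .plane, R => ¬ Bornology.IsBounded R.finitePart
  | .sphere, R => OnePoint.infty ∈ R.1

/-- Starting from `z` and moving in direction `w`, one is first in the region `R`. -/
def Region.LiesAt (R : P.Region A) (z w : ℂ) : Prop :=
  ∀ᶠ ε : ℝ in 𝓝[>] 0, z + ε * w ∈ R.finitePart

variable (P)

/-- The directions of the four corners at a crossing `x`: if `v`, `v'` are the velocities of the
two strands through `x`, these are `v + v'`, `v - v'`, `-v + v'`, `-v - v'`. -/
def cornerDirections (x : P.crossings) : Set ℂ :=
  {w | ∃ q q' : Strand l, q ≠ q' ∧ strandPoint P.curve q = x ∧ strandPoint P.curve q' = x ∧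
    ∃ s ∈ ({1, -1} : Set ℂ), ∃ s' ∈ ({1, -1} : Set ℂ),
      w = s * strandTangent P.curve q + s' * strandTangent P.curve q'}

variable {P}

/-- The region `R` touches the crossing `x` twice: it occupies two different corners at `x`. -/
def Region.TouchesTwice (R : P.Region A) (x : P.crossings) : Prop :=
  ∃ w ∈ P.cornerDirections x, ∃ w' ∈ P.cornerDirections x,
    w ≠ w' ∧ R.LiesAt x w ∧ R.LiesAt x w'

variable (P A)

open Classical in
/-- The definite region choice matrix of the single counting rule. -/
def matrixD1 : Matrix P.crossings (P.Region A) ℤ := fun x R =>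
  if (x : ℂ) ∈ frontier R.finitePart then 1 else 0

open Classical in
/-- The definite region choice matrix of the double counting rule. -/
def matrixD2 : Matrix P.crossings (P.Region A) ℤ := fun x R =>
  if R.TouchesTwice x then 2 else P.matrixD1 A x R

/-- The map `u ↦ A_{d2} u`. (A crossing lies on the boundary of at most four regions, so every
sum is finite.) -/
def mapD2 (u : P.Region A → ℤ) : P.crossings → ℤ := fun x => ∑ᶠ R, P.matrixD2 A x R * u R

variable {P A}

/-- Alexander numberings: across each oriented arc, the index of the region on the left exceeds
that of the region on the right by one. (`I * v` points to the left of `v`.) -/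
def IsAlexanderNumbering (a : P.Region A → ℤ) : Prop :=
  ∀ q : Strand l, strandPoint P.curve q ∉ P.crossings → ∀ L R : P.Region A,
    L.LiesAt (strandPoint P.curve q) (Complex.I * strandTangent P.curve q) →
    R.LiesAt (strandPoint P.curve q) (-(Complex.I * strandTangent P.curve q)) →
    a L = a R + 1

/-- Checkerboard colorings: Alexander numberings modulo `2`. -/
def IsCheckerboardColoring (c : P.Region A → ZMod 2) : Prop :=
  ∃ a : P.Region A → ℤ, IsAlexanderNumbering a ∧ ∀ R, c R = (a R : ZMod 2)

variable (P)

/-- The sub-projection consisting of the `i`-th component alone. -/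
def component (i : Fin l) : LinkProjection 1 where
  curve _ := P.curve i
  smooth _ := P.smooth i
  periodic _ := P.periodic i
  immersed _ := P.immersed i
  transverse q q' h e := P.transverse (i, q.2) (i, q'.2)
    (fun h' => h (Prod.ext (Subsingleton.elim _ _) (Prod.ext_iff.1 h').2)) e
  double q₁ q₂ q₃ e e' := by
    have key : ∀ q q' : Strand 1, ((i, q.2) : Strand l) = (i, q'.2) → q = q' := fun q q' h =>
      Prod.ext (Subsingleton.elim _ _) (Prod.ext_iff.1 h).2
    exact (P.double (i, q₁.2) (i, q₂.2) (i, q₃.2) e e').imp (key _ _)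
      (Or.imp (key _ _) (key _ _))
  finite_multiplePoints := P.finite_multiplePoints.subset <| by
    rintro z ⟨q, q', h, e, e'⟩
    exact ⟨(i, q.2), (i, q'.2),
      fun h' => h (Prod.ext (Subsingleton.elim _ _) (Prod.ext_iff.1 h').2), e, e'⟩

variable {P}

/-- Componentwise Alexander numberings associated with the `i`-th component: take an Alexander
numbering of that component alone, and give each region `R` of the whole projection the number of
the region `S` containing it. -/
def IsComponentwiseAlexanderNumbering (i : Fin l) (u : P.Region A → ℤ) : Prop :=
  ∃ a : (P.component i).Region A → ℤ, IsAlexanderNumbering a ∧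
    ∀ (R : P.Region A) (S : (P.component i).Region A), R.1 ⊆ S.1 → u R = a S

/-- The standard kernel solution associated with the `i`-th component: the componentwise Alexander
numbering that vanishes on the region `R_∞`. -/
def IsStandardKernelSolution (Rinf : P.Region A) (i : Fin l) (u : P.Region A → ℤ) : Prop :=
  IsComponentwiseAlexanderNumbering i u ∧ u Rinf = 0

/-- The vector `u` with the entry of each region `R` multiplied by `(-1) ^ (c R)`. -/
def signTwist (c : P.Region A → ZMod 2) (u : P.Region A → ℤ) : P.Region A → ℤ :=
  fun R => (-1) ^ (c R).val * u R

/-- The family `u_1, …, u_l, u_∞`, where `u_∞` (index `none`) is `1` on all regions. -/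
def withInfinity (u : Fin l → P.Region A → ℤ) : Option (Fin l) → P.Region A → ℤ
  | none => fun _ => 1
  | some i => u i

end LinkProjection

end

section

open Filter Set MeasureTheory

/-! Twisting by the checkerboard signs turns the kernel condition into a statement about jumps. The
entry of the matrix at a crossing and a region counts the corners that the region occupies, and the
Alexander numbers of the four corners alternate in parity. Hence `signTwist c f` lies in the kernel
exactly when `f Q₁ - f Q₂ + f Q₃ - f Q₄ = 0` at every crossing, the corners being taken in cyclic
order (`ker_mapD2_iff`). Rearranged, this says that the difference of `f` between the left and the
right of a strand is the same before and after the crossing. Such an `f` therefore has one jump `d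
i` along the whole `i`-th component (`exists_jump`).

The winding number of the `i`-th component jumps by one across that component and not at all across
the others (`IsSidePair.winding_eq`); normalised at `Rinf`, it is the vector `u i`. So `f - ∑ d i *
u i` has no jumps, and a function on the regions without jumps is constant because the plane is
connected (`eq_of_forall_isSidePair`). This gives generation over the integers. Independence is the
same computation read backwards: the coefficients are the jumps and the value at `Rinf`.

No Jordan curve theorem enters. Winding numbers come from the Cauchy integral, and the regions near
an arc or a crossing are found with the inverse function theorem, in a chart whose axes contain the
curves (`exists_arc_sides`, `exists_crossingCorners`). -/

/-- The integral of `dw / (w - z)` along a piece of a curve. -/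
noncomputable def cauchyIntegral (γ : ℝ → ℂ) (a b : ℝ) (z : ℂ) : ℂ :=
  ∫ t in a..b, deriv γ t / (γ t - z)

/-- The winding number of a closed curve of period `1` around a point. -/
noncomputable def windingNumber (γ : ℝ → ℂ) (z : ℂ) : ℤ :=
  round (cauchyIntegral γ 0 1 z / (2 * Real.pi * Complex.I)).re

/-! ### Winding numbers: integrality, local constancy, vanishing far away. -/

section Winding

variable {γ : ℝ → ℂ}

theorem hasDerivAt_of_contDiff (hγ : ContDiff ℝ (⊤ : ℕ∞) γ) (t : ℝ) :
    HasDerivAt γ (deriv γ t) t :=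
  ((hγ.differentiable (by simp)) t).hasDerivAt

theorem continuous_deriv_of_contDiff (hγ : ContDiff ℝ (⊤ : ℕ∞) γ) : Continuous (deriv γ) :=
  hγ.continuous_deriv (by simp)

/-- Dominated convergence: if the compact arc stays at distance `r` from `z₀`, the integrand is at
most `M / (r / 2)` for `z` within `r / 2`. General endpoints are allowed because the jump formula
needs the curve with a short piece removed. -/
theorem continuousAt_cauchyIntegral (hγ : ContDiff ℝ (⊤ : ℕ∞) γ) {a b : ℝ} {z₀ : ℂ}
    (h : ∀ t ∈ uIcc a b, γ t ≠ z₀) : ContinuousAt (cauchyIntegral γ a b) z₀ := by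
  have hd := continuous_deriv_of_contDiff hγ
  have hc := hγ.continuous
  obtain ⟨M, hM⟩ := (isCompact_uIcc (a := a) (b := b)).exists_bound_of_continuousOn hd.continuousOn
  have hK : IsClosed (γ '' uIcc a b) := (isCompact_uIcc.image hc).isClosed
  have hz : (γ '' uIcc a b)ᶜ ∈ 𝓝 z₀ := hK.isOpen_compl.mem_nhds (by
    rintro ⟨t, ht, e⟩
    exact h t ht e)
  obtain ⟨r, hr, hrs⟩ := Metric.mem_nhds_iff.1 hz
  have hlow : ∀ z ∈ Metric.ball z₀ (r / 2), ∀ t ∈ uIcc a b, r / 2 ≤ ‖γ t - z‖ := by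
    intro z hz' t ht
    have h1 : r ≤ dist (γ t) z₀ := by
      by_contra! hlt
      exact hrs (Metric.mem_ball.2 hlt) ⟨t, ht, rfl⟩
    have h2 := dist_triangle (γ t) z z₀
    rw [Metric.mem_ball] at hz'
    rw [← dist_eq_norm]
    linarith
  refine intervalIntegral.continuousAt_of_dominated_interval (bound := fun _ => M / (r / 2))
    ?_ ?_ ?_ ?_
  · refine Eventually.of_forall fun z => ?_
    exact (hd.measurable.div (hc.measurable.sub_const z)).aestronglyMeasurable
  · filter_upwards [Metric.ball_mem_nhds z₀ (half_pos hr)] with z hz'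
    refine Eventually.of_forall fun t ht => ?_
    have ht' := uIoc_subset_uIcc ht
    rw [norm_div]
    exact div_le_div₀ ((norm_nonneg _).trans (hM t ht')) (hM t ht') (half_pos hr) (hlow z hz' t ht')
  · exact intervalIntegrable_const
  · refine Eventually.of_forall fun t ht => ?_
    have ht' := uIoc_subset_uIcc ht
    exact continuousAt_const.div (continuousAt_const.sub continuousAt_id) (sub_ne_zero.2 (h t ht'))

theorem continuousOn_cauchyIntegrand (hγ : ContDiff ℝ (⊤ : ℕ∞) γ) {s : Set ℝ} {z : ℂ}
    (h : ∀ t ∈ s, γ t ≠ z) : ContinuousOn (fun t => deriv γ t / (γ t - z)) s :=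
  (continuous_deriv_of_contDiff hγ).continuousOn.div
    (hγ.continuous.sub continuous_const).continuousOn fun t ht => sub_ne_zero.2 (h t ht)

/-- The product of `γ s - z` with the exponential of minus the integral up to `s` has derivative
zero. For a closed curve it follows that the integral is a multiple of `2πi`, so the rounding in
`windingNumber` loses nothing off the curve. -/
theorem exp_cauchyIntegral (hγ : ContDiff ℝ (⊤ : ℕ∞) γ) {z : ℂ} (h : ∀ t, γ t ≠ z) (a b : ℝ) :
    Complex.exp (cauchyIntegral γ a b z) * (γ a - z) = γ b - z := by
  have hcont : Continuous (fun t => deriv γ t / (γ t - z)) :=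
    continuousOn_univ.1 (continuousOn_cauchyIntegrand hγ fun t _ => h t)
  have hF : ∀ s, HasDerivAt (fun s => cauchyIntegral γ a s z) (deriv γ s / (γ s - z)) s :=
    fun s => hcont.integral_hasStrictDerivAt a s |>.hasDerivAt
  have hG : ∀ s, HasDerivAt (fun s => Complex.exp (-cauchyIntegral γ a s z) * (γ s - z)) 0 s := by
    intro s
    have h1 := ((hF s).neg.cexp).mul ((hasDerivAt_of_contDiff hγ s).sub_const z)
    refine h1.congr_deriv ?_
    have := sub_ne_zero.2 (h s)
    field_simp
    ring
  have hconst := is_const_of_deriv_eq_zero (fun s => (hG s).differentiableAt)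
    (fun s => (hG s).deriv) a b
  have h0 : cauchyIntegral γ a a z = 0 := by simp [cauchyIntegral]
  simp only [h0, neg_zero, Complex.exp_zero, one_mul] at hconst
  rw [hconst, ← mul_assoc, ← Complex.exp_add]
  simp

theorem cauchyIntegral_eq (hγ : ContDiff ℝ (⊤ : ℕ∞) γ) (hp : Function.Periodic γ 1) {z : ℂ}
    (h : ∀ t, γ t ≠ z) :
    cauchyIntegral γ 0 1 z = windingNumber γ z * (2 * Real.pi * Complex.I) := by
  have h1 := exp_cauchyIntegral hγ h 0 1
  have h2 : γ 1 = γ 0 := by simpa using hp 0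
  rw [h2] at h1
  have h3 : Complex.exp (cauchyIntegral γ 0 1 z) = 1 :=
    mul_right_cancel₀ (sub_ne_zero.2 (h 0)) (by rw [h1, one_mul])
  obtain ⟨n, hn⟩ := Complex.exp_eq_one_iff.1 h3
  have h4 : windingNumber γ z = n := by
    rw [windingNumber, hn, mul_div_cancel_right₀ _ Complex.two_pi_I_ne_zero]
    simp
  rw [h4, hn]

/-- Distinct multiples of `2πi` are more than `1` apart. This converts estimates and limits of
integrals into equalities of winding numbers. -/
theorem int_eq_of_norm_lt {m n : ℤ} {a b : ℂ} (ha : a = m * (2 * Real.pi * Complex.I))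
    (hb : b = n * (2 * Real.pi * Complex.I)) (h : ‖a - b‖ < 1) : m = n := by
  by_contra hne
  have h1 : (1 : ℝ) ≤ |((m - n : ℤ) : ℝ)| := by
    exact_mod_cast Int.one_le_abs (sub_ne_zero.2 hne)
  have h2 : a - b = ((m - n : ℤ) : ℂ) * (2 * Real.pi * Complex.I) := by
    rw [ha, hb]; push_cast; ring
  rw [h2, norm_mul, Complex.norm_intCast, norm_mul, norm_mul, Complex.norm_I] at h
  simp only [Complex.norm_ofNat, Complex.norm_real, Real.norm_eq_abs, abs_of_pos Real.pi_pos] at h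
  nlinarith [Real.pi_gt_three]

theorem isClosed_range_of_periodic (hc : Continuous γ) (hp : Function.Periodic γ 1) :
    IsClosed (range γ) := by
  rw [← hp.image_Icc one_pos 0]
  exact (isCompact_Icc.image hc).isClosed

theorem eventually_windingNumber_eq (hγ : ContDiff ℝ (⊤ : ℕ∞) γ) (hp : Function.Periodic γ 1)
    {z₀ : ℂ} (h : ∀ t, γ t ≠ z₀) : ∀ᶠ z in 𝓝 z₀, windingNumber γ z = windingNumber γ z₀ := by
  have h1 := continuousAt_cauchyIntegral hγ (a := 0) (b := 1) fun t _ => h t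
  have h2 : ∀ᶠ z in 𝓝 z₀, z ∈ (range γ)ᶜ :=
    (isClosed_range_of_periodic hγ.continuous hp).isOpen_compl.mem_nhds (by rintro ⟨t, e⟩; exact h t e)
  filter_upwards [h2, Metric.tendsto_nhds.1 h1 1 one_pos] with z hz hd
  rw [dist_eq_norm] at hd
  exact int_eq_of_norm_lt (cauchyIntegral_eq hγ hp fun t e => hz ⟨t, e⟩) (cauchyIntegral_eq hγ hp h) hd

theorem exists_norm_le_of_periodic (hc : Continuous γ) (hp : Function.Periodic γ 1) :
    ∃ r, ∀ t, ‖γ t‖ ≤ r := by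
  obtain ⟨r, hr⟩ := (isCompact_Icc (a := (0 : ℝ)) (b := 0 + 1)).exists_bound_of_continuousOn
    hc.continuousOn
  refine ⟨r, fun t => ?_⟩
  have : γ t ∈ γ '' Icc 0 (0 + 1) := by rw [hp.image_Icc one_pos 0]; exact ⟨t, rfl⟩
  obtain ⟨s, hs, e⟩ := this
  rw [← e]
  exact hr s hs

theorem exists_windingNumber_eq_zero (hγ : ContDiff ℝ (⊤ : ℕ∞) γ) (hp : Function.Periodic γ 1) :
    ∃ r, ∀ z : ℂ, r < ‖z‖ → windingNumber γ z = 0 := by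
  obtain ⟨C, hC⟩ := exists_norm_le_of_periodic hγ.continuous hp
  obtain ⟨M, hM⟩ := (isCompact_uIcc (a := (0 : ℝ)) (b := 1)).exists_bound_of_continuousOn
    (continuous_deriv_of_contDiff hγ).continuousOn
  have hM0 : 0 ≤ M := (norm_nonneg _).trans (hM 0 (by simp))
  -- Beyond this radius `‖γ t - z‖ ≥ M + 1`, so the integral has norm at most `M / (M + 1) < 1`.
  refine ⟨C + M + 1, fun z hz => ?_⟩
  have hlow : ∀ t, M + 1 ≤ ‖γ t - z‖ := by
    intro t
    have h1 := norm_sub_norm_le z (γ t)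
    have h2 := hC t
    rw [norm_sub_rev] at h1
    linarith
  have hne : ∀ t, γ t ≠ z := by
    intro t e
    have := hlow t
    rw [e, sub_self, norm_zero] at this
    linarith
  refine int_eq_of_norm_lt (cauchyIntegral_eq hγ hp hne) (b := 0) (by simp) ?_
  rw [sub_zero]
  have : ‖cauchyIntegral γ 0 1 z‖ ≤ M / (M + 1) * |1 - 0| := by
    refine intervalIntegral.norm_integral_le_of_norm_le_const fun t ht => ?_
    rw [norm_div]
    exact div_le_div₀ hM0 (hM t (uIoc_subset_uIcc ht)) (by linarith) (hlow t)
  refine this.trans_lt ?_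
  rw [sub_zero, abs_one, mul_one, div_lt_one (by linarith)]
  linarith

/-- The factor `c` cancels in the logarithmic derivative; it serves to rotate the arc away from the
branch cut. -/
theorem cauchyIntegral_eq_log_sub (hγ : ContDiff ℝ (⊤ : ℕ∞) γ) {a b : ℝ} {z c : ℂ} (hc : c ≠ 0)
    (h : ∀ t ∈ uIcc a b, c * (γ t - z) ∈ Complex.slitPlane) :
    cauchyIntegral γ a b z = Complex.log (c * (γ b - z)) - Complex.log (c * (γ a - z)) := by
  have hne : ∀ t ∈ uIcc a b, γ t ≠ z := by
    intro t ht e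
    have := Complex.slitPlane_ne_zero (h t ht)
    simp [e] at this
  refine intervalIntegral.integral_eq_sub_of_hasDerivAt
    (f := fun t => Complex.log (c * (γ t - z))) (fun t ht => ?_)
    (continuousOn_cauchyIntegrand hγ hne).intervalIntegrable
  have h1 := (((hasDerivAt_of_contDiff hγ t).sub_const z).const_mul c).clog_real (h t ht)
  refine h1.congr_deriv ?_
  rw [mul_div_mul_left _ _ hc]

theorem log_mul_I_sub_log {w : ℂ} (hw : 0 < w.re) :
    Complex.log (Complex.I * w) - Complex.log (-Complex.I * w) = Real.pi * Complex.I := by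
  have h1 : 0 < (Complex.I * w).im := by simpa using hw
  have h2 := Complex.arg_neg_eq_arg_sub_pi_of_im_pos h1
  rw [neg_mul, Complex.log, Complex.log, h2, norm_neg]
  push_cast
  ring

theorem log_mul_I_sub_log' {w : ℂ} (hw : w.re < 0) :
    Complex.log (Complex.I * w) - Complex.log (-Complex.I * w) = -(Real.pi * Complex.I) := by
  have h1 := log_mul_I_sub_log (w := -w) (by simpa using hw)
  simp only [mul_neg, neg_mul, neg_neg] at h1 ⊢
  linear_combination -h1

end Winding

/-! ### The jump of the winding number across an arc. -/

section WindingJump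

variable {γ : ℝ → ℂ}

theorem periodic_deriv (hp : Function.Periodic γ 1) : Function.Periodic (deriv γ) 1 := by
  intro t
  rw [← deriv_comp_add_const]
  congr 1
  exact funext hp

theorem cauchyIntegral_period (hγ : ContDiff ℝ (⊤ : ℕ∞) γ) (hp : Function.Periodic γ 1) {z : ℂ}
    (h : ∀ t, γ t ≠ z) (a b : ℝ) :
    cauchyIntegral γ 0 1 z = cauchyIntegral γ a b z + cauchyIntegral γ b (a + 1) z := by
  have hcont : Continuous (fun t => deriv γ t / (γ t - z)) :=
    continuousOn_univ.1 (continuousOn_cauchyIntegrand hγ fun t _ => h t)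
  have hper : Function.Periodic (fun t => deriv γ t / (γ t - z)) 1 := fun t => by
    simp only [hp t, periodic_deriv hp t]
  have h1 := hper.intervalIntegral_add_eq 0 a
  rw [zero_add] at h1
  rw [cauchyIntegral, h1, cauchyIntegral, cauchyIntegral,
    intervalIntegral.integral_add_adjacent_intervals (hcont.intervalIntegrable _ _)
      (hcont.intervalIntegrable _ _)]

theorem eventually_sign_of_hasDerivAt {g : ℝ → ℝ} {c t₀ : ℝ} (hg : HasDerivAt g c t₀) (hc : 0 < c)
    (h0 : g t₀ = 0) : ∀ᶠ t in 𝓝 t₀, (t₀ < t → 0 < g t) ∧ (t < t₀ → g t < 0) := by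
  have h1 := (hasDerivAt_iff_tendsto_slope.1 hg).eventually (lt_mem_nhds hc)
  filter_upwards [eventually_nhdsWithin_iff.1 h1] with t ht
  refine ⟨fun hlt => ?_, fun hlt => ?_⟩
  · have := ht (ne_of_gt hlt)
    rw [slope_def_field, h0, sub_zero] at this
    exact (div_pos_iff_of_pos_right (sub_pos.2 hlt)).1 this
  · have := ht (ne_of_lt hlt)
    rw [slope_def_field, h0, sub_zero, div_pos_iff] at this
    rcases this with h | h
    · linarith [h.2]
    · exact h.1

/-- A period is split into a short piece around `t₀` and the rest. The rest contributes continuously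
at `γ t₀`, so it cancels in the limit; the short piece is evaluated by logarithms, and its limits
from the two sides differ by `2πi`. -/
theorem eventually_windingNumber_jump (hγ : ContDiff ℝ (⊤ : ℕ∞) γ) (hp : Function.Periodic γ 1)
    {t₀ : ℝ} (hd : deriv γ t₀ ≠ 0) (hs : ∀ t, γ t = γ t₀ → ∃ n : ℤ, t = t₀ + n) :
    ∀ᶠ ε : ℝ in 𝓝[>] 0, (∀ t, γ t ≠ γ t₀ + ε * (Complex.I * deriv γ t₀)) →
      (∀ t, γ t ≠ γ t₀ + ε * (-(Complex.I * deriv γ t₀))) →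
      windingNumber γ (γ t₀ + ε * (Complex.I * deriv γ t₀)) =
        windingNumber γ (γ t₀ + ε * (-(Complex.I * deriv γ t₀))) + 1 := by
  set v := deriv γ t₀ with hv
  set ζ : ℝ → ℂ := fun t => (γ t - γ t₀) / v with hζ
  have hζd : HasDerivAt ζ 1 t₀ := by
    have := ((hasDerivAt_of_contDiff hγ t₀).sub_const (γ t₀)).div_const v
    rwa [← hv, div_self hd] at this
  have hre : HasDerivAt (fun t => (ζ t).re) 1 t₀ :=
    Complex.reCLM.hasFDerivAt.comp_hasDerivAt t₀ hζd
  have hsign := eventually_sign_of_hasDerivAt hre one_pos (by simp [hζ])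
  obtain ⟨r, hr, hball⟩ := Metric.eventually_nhds_iff.1 hsign
  -- With `δ < 1 / 2` the remaining interval `[t₀ + δ, t₀ - δ + 1]` is correctly ordered and
  -- contains no integer translate of `t₀`.
  obtain ⟨δ, hδ0, hδr, hδ2⟩ : ∃ δ : ℝ, 0 < δ ∧ δ < r ∧ δ < 1 / 2 :=
    ⟨min r (1 / 2) / 2, by positivity, by
      have := min_le_left r (1 / 2); linarith, by have := min_le_right r (1 / 2); linarith⟩
  have hsg : ∀ t ∈ Icc (t₀ - δ) (t₀ + δ), (t₀ < t → 0 < (ζ t).re) ∧ (t < t₀ → (ζ t).re < 0) := by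
    intro t ht
    refine hball ?_
    rw [Real.dist_eq, abs_lt]
    constructor <;> linarith [ht.1, ht.2]
  have hpos : 0 < (ζ (t₀ + δ)).re := (hsg _ ⟨by linarith, le_rfl⟩).1 (by linarith)
  have hneg : (ζ (t₀ - δ)).re < 0 := (hsg _ ⟨le_rfl, by linarith⟩).2 (by linarith)
  -- The values `s = I` and `s = -I` are the left and the right side. Multiplication by `s / v`
  -- turns the short piece into `s * ζ t + ε`, which is `ε > 0` at `t₀` and non-real elsewhere, so
  -- it avoids the branch cut.
  have hlogs : ∀ ε : ℝ, 0 < ε → ∀ s : ℂ, s = Complex.I ∨ s = -Complex.I →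
      cauchyIntegral γ (t₀ - δ) (t₀ + δ) (γ t₀ + ε * (s * v)) =
        Complex.log (s * ζ (t₀ + δ) + ε) - Complex.log (s * ζ (t₀ - δ) + ε) := by
    intro ε hε s hs
    have hs2 : s * s = -1 := by
      rcases hs with rfl | rfl <;> simp
    have hs0 : s ≠ 0 := by
      rintro rfl
      simp at hs2
    have heq : ∀ t, s / v * (γ t - (γ t₀ + ε * (s * v))) = s * ζ t + ε := by
      intro t
      simp only [hζ]
      field_simp
      linear_combination (-(ε : ℂ) * v) * hs2
    rw [cauchyIntegral_eq_log_sub hγ (c := s / v) (div_ne_zero hs0 hd), heq, heq]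
    intro t ht
    rw [uIcc_of_le (by linarith)] at ht
    rw [heq, Complex.mem_slitPlane_iff]
    rcases lt_trichotomy t t₀ with hlt | rfl | hlt
    · right
      have := (hsg t ht).2 hlt
      rcases hs with rfl | rfl <;> simp [this.ne]
    · left
      simp [hζ, hε]
    · right
      have := (hsg t ht).1 hlt
      rcases hs with rfl | rfl <;> simp [this.ne']
  have hlim : ∀ s : ℂ, s = Complex.I ∨ s = -Complex.I →
      Tendsto (fun ε : ℝ => cauchyIntegral γ (t₀ - δ) (t₀ + δ) (γ t₀ + ε * (s * v))) (𝓝[>] 0)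
        (𝓝 (Complex.log (s * ζ (t₀ + δ)) - Complex.log (s * ζ (t₀ - δ)))) := by
    intro s hs
    have h1 : ∀ w : ℂ, w.re ≠ 0 → Tendsto (fun ε : ℝ => Complex.log (s * w + ε)) (𝓝[>] 0)
        (𝓝 (Complex.log (s * w))) := by
      intro w hw
      have h2 : Tendsto (fun ε : ℝ => s * w + (ε : ℂ)) (𝓝[>] 0) (𝓝 (s * w)) := by
        have : Continuous (fun ε : ℝ => s * w + (ε : ℂ)) := by fun_prop
        simpa using (this.tendsto 0).mono_left nhdsWithin_le_nhds
      refine h2.clog ?_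
      rw [Complex.mem_slitPlane_iff]
      right
      rcases hs with rfl | rfl <;> simp [hw]
    refine ((h1 _ hpos.ne').sub (h1 _ hneg.ne)).congr' ?_
    filter_upwards [self_mem_nhdsWithin] with ε hε
    exact (hlogs ε hε s hs).symm
  have hrest : ∀ s : ℂ,
      Tendsto (fun ε : ℝ => cauchyIntegral γ (t₀ + δ) (t₀ - δ + 1) (γ t₀ + ε * (s * v))) (𝓝[>] 0)
        (𝓝 (cauchyIntegral γ (t₀ + δ) (t₀ - δ + 1) (γ t₀))) := by
    intro s
    have h1 : ContinuousAt (cauchyIntegral γ (t₀ + δ) (t₀ - δ + 1)) (γ t₀) := by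
      refine continuousAt_cauchyIntegral hγ fun t ht e => ?_
      rw [uIcc_of_le (by linarith)] at ht
      obtain ⟨n, hn⟩ := hs t e
      have h2 : (0 : ℝ) < n := by linarith [ht.1]
      have h3 : (n : ℝ) < 1 := by linarith [ht.2]
      have h4 : 0 < n := by exact_mod_cast h2
      have h5 : n < 1 := by exact_mod_cast h3
      omega
    refine h1.tendsto.comp ?_
    have : Continuous (fun ε : ℝ => γ t₀ + ε * (s * v)) := by fun_prop
    simpa using (this.tendsto 0).mono_left nhdsWithin_le_nhds
  have htot := ((hlim _ (Or.inl rfl)).add (hrest Complex.I)).sub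
    ((hlim _ (Or.inr rfl)).add (hrest (-Complex.I)))
  have hval : Complex.log (Complex.I * ζ (t₀ + δ)) - Complex.log (Complex.I * ζ (t₀ - δ)) +
      cauchyIntegral γ (t₀ + δ) (t₀ - δ + 1) (γ t₀) -
      (Complex.log (-Complex.I * ζ (t₀ + δ)) - Complex.log (-Complex.I * ζ (t₀ - δ)) +
        cauchyIntegral γ (t₀ + δ) (t₀ - δ + 1) (γ t₀)) = 2 * Real.pi * Complex.I := by
    linear_combination log_mul_I_sub_log hpos - log_mul_I_sub_log' hneg
  rw [hval] at htot
  filter_upwards [Metric.tendsto_nhds.1 htot 1 one_pos] with ε hε hl hr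
  rw [← neg_mul] at hr ⊢
  rw [dist_eq_norm, ← cauchyIntegral_period hγ hp hl, ← cauchyIntegral_period hγ hp hr] at hε
  refine int_eq_of_norm_lt (cauchyIntegral_eq hγ hp hl)
    (b := cauchyIntegral γ 0 1 (γ t₀ + ε * (-Complex.I * v)) + 2 * Real.pi * Complex.I) ?_ ?_
  · rw [cauchyIntegral_eq hγ hp hr]
    push_cast
    ring
  · rwa [← sub_sub]

end WindingJump

/-! ### Regions as connected sets, on the plane and on the sphere. -/

theorem isPreconnected_setOf_lt_norm (r : ℝ) : IsPreconnected {z : ℂ | r < ‖z‖} := by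
  have h1 : IsPreconnected (Ioi r ×ˢ (univ : Set ℝ)) :=
    isPreconnected_Ioi.prod isPreconnected_univ
  have h2 := h1.image (fun x : ℝ × ℝ => (x.1 : ℂ) * Complex.exp (x.2 * Complex.I))
    (by fun_prop)
  convert h2
  ext z
  constructor
  · intro hz
    exact ⟨(‖z‖, z.arg), ⟨hz, mem_univ _⟩, Complex.norm_mul_exp_arg_mul_I z⟩
  · rintro ⟨⟨ρ, θ⟩, ⟨hρ, -⟩, rfl⟩
    have hρ' : r < ρ := hρ
    simp only [mem_ofPred_eq, norm_mul, Complex.norm_real, Complex.norm_exp_ofReal_mul_I, mul_one,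
      Real.norm_eq_abs]
    exact hρ'.trans_le (le_abs_self ρ)

namespace LinkProjection

variable {l : ℕ} (P : LinkProjection l) {A : Ambient}

theorem mem_image_curve (i : Fin l) (t : ℝ) : P.curve i t ∈ P.image :=
  mem_iUnion.2 ⟨i, t, rfl⟩

theorem mem_image_iff {z : ℂ} : z ∈ P.image ↔ ∃ i t, P.curve i t = z := by
  simp [image]

theorem isClosed_image : IsClosed P.image :=
  isClosed_iUnion_of_finite fun i => isClosed_range_of_periodic (P.smooth i).continuous (P.periodic i)

theorem exists_image_norm_le : ∃ r, ∀ z ∈ P.image, ‖z‖ ≤ r := by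
  choose C hC using fun i => exists_norm_le_of_periodic (P.smooth i).continuous (P.periodic i)
  refine ⟨∑ i, |C i|, fun z hz => ?_⟩
  obtain ⟨i, t, rfl⟩ := P.mem_image_iff.1 hz
  exact ((hC i t).trans (le_abs_self _)).trans
    (Finset.single_le_sum (f := fun i => |C i|) (fun i _ => abs_nonneg _) (Finset.mem_univ i))

theorem coe_mem_complement {z : ℂ} : (z : OnePoint ℂ) ∈ P.complement A ↔ z ∉ P.image := by
  have h1 : (z : OnePoint ℂ) ∈ A.carrier := by
    cases A
    · exact ⟨z, rfl⟩
    · exact mem_univ _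
  simp [complement, h1]

variable {P}

namespace Region

theorem notMem_image {R : P.Region A} {z : ℂ} (hz : z ∈ R.finitePart) : z ∉ P.image := by
  obtain ⟨S, x, hx, rfl⟩ := R
  exact P.coe_mem_complement.1 (connectedComponentIn_subset _ _ hz)

theorem exists_mem {z : ℂ} (hz : z ∉ P.image) : ∃ R : P.Region A, z ∈ R.finitePart :=
  ⟨⟨connectedComponentIn (P.complement A) z, z, P.coe_mem_complement.2 hz, rfl⟩,
    mem_connectedComponentIn (P.coe_mem_complement.2 hz)⟩

theorem subset_of_isPreconnected {R : P.Region A} {S : Set (OnePoint ℂ)} (hS : IsPreconnected S)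
    (hSP : S ⊆ P.complement A) (h : (R.1 ∩ S).Nonempty) : S ⊆ R.1 := by
  obtain ⟨R, x, hx, rfl⟩ := R
  obtain ⟨y, hy, hyS⟩ := h
  have := hS.subset_connectedComponentIn hyS hSP
  rwa [← connectedComponentIn_eq hy] at this

theorem eq_of_nonempty_inter {R R' : P.Region A} (h : (R.1 ∩ R'.1).Nonempty) : R = R' := by
  obtain ⟨y, hy, hy'⟩ := h
  obtain ⟨R, x, hx, rfl⟩ := R
  obtain ⟨R', x', hx', rfl⟩ := R'
  exact Subtype.ext ((connectedComponentIn_eq hy).trans (connectedComponentIn_eq hy').symm)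

theorem eq_of_mem {R R' : P.Region A} {z : ℂ} (h : z ∈ R.finitePart) (h' : z ∈ R'.finitePart) :
    R = R' := eq_of_nonempty_inter ⟨z, h, h'⟩

theorem subset_finitePart {R : P.Region A} {S : Set ℂ} (hS : IsPreconnected S)
    (hSP : ∀ z ∈ S, z ∉ P.image) {z : ℂ} (hz : z ∈ R.finitePart) (hzS : z ∈ S) :
    S ⊆ R.finitePart := by
  have h1 := subset_of_isPreconnected (R := R)
    (hS.image _ OnePoint.continuous_coe.continuousOn)
    (by rintro _ ⟨w, hw, rfl⟩; exact P.coe_mem_complement.2 (hSP w hw)) ⟨z, hz, z, hzS, rfl⟩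
  exact fun w hw => h1 ⟨w, hw, rfl⟩

theorem isOpen_finitePart (R : P.Region A) : IsOpen R.finitePart := by
  refine Metric.isOpen_iff.2 fun z hz => ?_
  obtain ⟨r, hr, h⟩ := Metric.isOpen_iff.1 P.isClosed_image.isOpen_compl z (notMem_image hz)
  exact ⟨r, hr, subset_finitePart (convex_ball z r).isPreconnected (fun w hw => h hw) hz
    (Metric.mem_ball_self hr)⟩

theorem nonempty_finitePart (R : P.Region A) : R.finitePart.Nonempty := by
  obtain ⟨x, hx, hR⟩ := R.2
  have hxR : x ∈ R.1 := by rw [hR]; exact mem_connectedComponentIn hx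
  cases x with
  | coe z => exact ⟨z, hxR⟩
  | infty =>
    -- Outside a disc containing the image, the finite points together with `∞` form a connected
    -- subset of the complement, so a region containing `∞` contains them.
    obtain ⟨r, h⟩ := P.exists_image_norm_le
    set S : Set (OnePoint ℂ) := (↑) '' {z : ℂ | r < ‖z‖} with hS
    have hSpre : IsPreconnected S :=
      (isPreconnected_setOf_lt_norm r).image _ OnePoint.continuous_coe.continuousOn
    have hev : ∀ᶠ z in coclosedCompact ℂ, r < ‖z‖ := by
      rw [coclosedCompact_eq_cocompact]
      exact tendsto_norm_cocompact_atTop.eventually_gt_atTop r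
    have hcl : OnePoint.infty ∈ closure S :=
      mem_closure_of_tendsto OnePoint.tendsto_coe_infty (hev.mono fun z hz => ⟨z, hz, rfl⟩)
    have hpre : IsPreconnected (insert OnePoint.infty S) :=
      hSpre.subset_closure (subset_insert _ _) (insert_subset hcl subset_closure)
    have hsub : insert OnePoint.infty S ⊆ P.complement A := by
      refine insert_subset hx ?_
      rintro _ ⟨z, hz, rfl⟩
      exact P.coe_mem_complement.2 fun hzi => (h z hzi).not_gt hz
    have h1 := subset_of_isPreconnected hpre hsub ⟨_, hxR, mem_insert _ _⟩
    obtain ⟨z, hz⟩ := hev.exists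
    exact ⟨z, h1 (mem_insert_of_mem _ ⟨z, hz, rfl⟩)⟩

/-- A region of the sphere may be connected only through `∞`. Extending `w` there by its value `c`
far away keeps it continuous into the discrete space `ℤ`. -/
theorem eq_of_locally_constant (R : P.Region A) {w : ℂ → ℤ} {c : ℤ} {r : ℝ}
    (hw : ∀ z ∉ P.image, ∀ᶠ z' in 𝓝 z, w z' = w z) (hc : ∀ z : ℂ, r < ‖z‖ → w z = c) {z z' : ℂ}
    (hz : z ∈ R.finitePart) (hz' : z' ∈ R.finitePart) : w z = w z' := by
  let g : OnePoint ℂ → ℤ := fun o => o.elim c w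
  have hpre : IsPreconnected R.1 := by
    obtain ⟨x, hx, hR⟩ := R.2
    rw [hR]
    exact isPreconnected_connectedComponentIn
  have hcont : ContinuousOn g R.1 := by
    intro o ho
    refine ContinuousAt.continuousWithinAt ?_
    cases o with
    | coe z =>
      rw [OnePoint.continuousAt_coe]
      exact tendsto_nhds_of_eventually_eq (hw z (notMem_image ho))
    | infty =>
      rw [OnePoint.continuousAt_infty']
      refine tendsto_nhds_of_eventually_eq ?_
      rw [coclosedCompact_eq_cocompact]
      filter_upwards [tendsto_norm_cocompact_atTop.eventually_gt_atTop r] with z hz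
      exact hc z hz
  exact hpre.constant hcont hz hz'

theorem LiesAt.eq {R R' : P.Region A} {z w : ℂ} (h : R.LiesAt z w) (h' : R'.LiesAt z w) :
    R = R' := by
  obtain ⟨ε, h1, h2⟩ := (h.and h').exists
  exact eq_of_mem h1 h2

end Region

end LinkProjection

/-! ### Frames, and charts adapted to two transverse curves. -/

/-- The oriented area spanned by two plane vectors. -/
def planeDet (a b : ℂ) : ℝ := a.re * b.im - a.im * b.re

/-- The linear coordinates of the plane given by a frame. -/
noncomputable def frameEquiv (a b : ℂ) (h : planeDet a b ≠ 0) : (ℝ × ℝ) ≃L[ℝ] ℂ :=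
  LinearEquiv.toContinuousLinearEquiv
    { toFun := fun q => (q.1 : ℂ) * a + (q.2 : ℂ) * b
      map_add' := fun q q' => by simp only [Prod.fst_add, Prod.snd_add]; push_cast; ring
      map_smul' := fun c q => by
        simp only [Prod.smul_fst, Prod.smul_snd, smul_eq_mul, Complex.real_smul, RingHom.id_apply]
        push_cast
        ring
      invFun := fun w => (planeDet w b / planeDet a b, planeDet a w / planeDet a b)
      left_inv := fun q => by
        ext
        · rw [div_eq_iff h]; simp [planeDet]; ring
        · rw [div_eq_iff h]; simp [planeDet]; ring
      right_inv := fun w => by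
        have hc : (planeDet a b : ℂ) ≠ 0 := by exact_mod_cast h
        push_cast
        rw [div_mul_eq_mul_div, div_mul_eq_mul_div, ← add_div, div_eq_iff hc]
        apply Complex.ext <;> simp [planeDet] <;> ring }

theorem frameEquiv_apply {a b : ℂ} (h : planeDet a b ≠ 0) (q : ℝ × ℝ) :
    frameEquiv a b h q = (q.1 : ℂ) * a + (q.2 : ℂ) * b := rfl

/-- The chart of the plane spanned by two curves through the point `p`. -/
def crossChart (α β : ℝ → ℂ) (p : ℂ) (q : ℝ × ℝ) : ℂ := α q.1 + β q.2 - p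

section Chart

variable {α β : ℝ → ℂ}

theorem hasStrictFDerivAt_crossChart (hα : ContDiff ℝ (⊤ : ℕ∞) α) (hβ : ContDiff ℝ (⊤ : ℕ∞) β)
    (p : ℂ) (q : ℝ × ℝ) (h : planeDet (deriv α q.1) (deriv β q.2) ≠ 0) :
    HasStrictFDerivAt (crossChart α β p)
      (frameEquiv (deriv α q.1) (deriv β q.2) h : ℝ × ℝ →L[ℝ] ℂ) q := by
  have h1 : HasStrictDerivAt α (deriv α q.1) q.1 :=
    hα.contDiffAt.hasStrictDerivAt (by simp)
  have h2 : HasStrictDerivAt β (deriv β q.2) q.2 :=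
    hβ.contDiffAt.hasStrictDerivAt (by simp)
  have h3 := ((h1.hasStrictFDerivAt.comp q hasStrictFDerivAt_fst).add
    (h2.hasStrictFDerivAt.comp q hasStrictFDerivAt_snd)).sub_const p
  refine h3.congr_fderiv ?_
  ext <;> simp [frameEquiv_apply]

/-- Moving from the point with chart coordinates `q` in direction `w`, the chart coordinates change
according to the coordinates of `w` in the frame of the chart. -/
theorem exists_chart_path (hα : ContDiff ℝ (⊤ : ℕ∞) α) (hβ : ContDiff ℝ (⊤ : ℕ∞) β)
    (p : ℂ) (q : ℝ × ℝ) (h : 0 < planeDet (deriv α q.1) (deriv β q.2)) (w : ℂ) :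
    ∃ X : ℝ → ℝ × ℝ, Tendsto X (𝓝[>] 0) (𝓝 q) ∧
      (∀ᶠ ε : ℝ in 𝓝[>] 0, crossChart α β p (X ε) = crossChart α β p q + ε * w) ∧
      (0 < planeDet w (deriv β q.2) → ∀ᶠ ε in 𝓝[>] 0, q.1 < (X ε).1) ∧
      (planeDet w (deriv β q.2) < 0 → ∀ᶠ ε in 𝓝[>] 0, (X ε).1 < q.1) ∧
      (0 < planeDet (deriv α q.1) w → ∀ᶠ ε in 𝓝[>] 0, q.2 < (X ε).2) ∧
      (planeDet (deriv α q.1) w < 0 → ∀ᶠ ε in 𝓝[>] 0, (X ε).2 < q.2) := by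
  have hst := hasStrictFDerivAt_crossChart hα hβ p q h.ne'
  set g := hst.localInverse with hg
  set f : ℝ → ℂ := fun ε => crossChart α β p q + ε * w with hf
  have hf0 : f 0 = crossChart α β p q := by simp [hf]
  have hfd : HasDerivAt f w 0 := by
    have := ((Complex.ofRealCLM.hasDerivAt (x := (0 : ℝ))).mul_const w).const_add
      (crossChart α β p q)
    exact this.congr_deriv (by simp)
  have hgd : HasFDerivAt g
      ((frameEquiv (deriv α q.1) (deriv β q.2) h.ne').symm : ℂ →L[ℝ] ℝ × ℝ) (f 0) := by
    rw [hf0]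
    exact hst.to_localInverse.hasFDerivAt
  have hX : HasDerivAt (g ∘ f) ((frameEquiv (deriv α q.1) (deriv β q.2) h.ne').symm w) 0 := hgd.comp_hasDerivAt 0 hfd
  have hX0 : (g ∘ f) 0 = q := by
    rw [Function.comp_apply, hf0]
    exact hst.localInverse_apply_image
  have hX1 : HasDerivAt (fun ε => ((g ∘ f) ε).1 - q.1)
      (planeDet w (deriv β q.2) / planeDet (deriv α q.1) (deriv β q.2)) 0 :=
    ((ContinuousLinearMap.fst ℝ ℝ ℝ).hasFDerivAt.comp_hasDerivAt (0 : ℝ) hX).sub_const q.1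
  have hX2 : HasDerivAt (fun ε => ((g ∘ f) ε).2 - q.2)
      (planeDet (deriv α q.1) w / planeDet (deriv α q.1) (deriv β q.2)) 0 :=
    ((ContinuousLinearMap.snd ℝ ℝ ℝ).hasFDerivAt.comp_hasDerivAt (0 : ℝ) hX).sub_const q.2
  have key : ∀ {u : ℝ → ℝ} {c : ℝ}, HasDerivAt u c 0 → u 0 = 0 → 0 < c →
      ∀ᶠ ε in 𝓝[>] 0, 0 < u ε := by
    intro u c hu h0 hc
    filter_upwards [self_mem_nhdsWithin,
      nhdsWithin_le_nhds (eventually_sign_of_hasDerivAt hu hc h0)] with ε hε h1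
    exact h1.1 hε
  have h01 : ((g ∘ f) 0).1 - q.1 = 0 := by rw [hX0, sub_self]
  have h02 : ((g ∘ f) 0).2 - q.2 = 0 := by rw [hX0, sub_self]
  refine ⟨g ∘ f, ?_, ?_, fun hw => ?_, fun hw => ?_, fun hw => ?_, fun hw => ?_⟩
  · have := hX.continuousAt.tendsto
    rw [hX0] at this
    exact this.mono_left nhdsWithin_le_nhds
  · have h1 := hst.eventually_right_inverse
    rw [← hf0] at h1
    exact nhdsWithin_le_nhds (hfd.continuousAt.eventually h1)
  · filter_upwards [key hX1 h01 (div_pos hw h)] with ε hε using sub_pos.1 hε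
  · filter_upwards [key hX1.neg (neg_eq_zero.2 h01) (neg_pos.2 (div_neg_of_neg_of_pos hw h))] with ε hε
    exact sub_neg.1 (neg_pos.1 hε)
  · filter_upwards [key hX2 h02 (div_pos hw h)] with ε hε using sub_pos.1 hε
  · filter_upwards [key hX2.neg (neg_eq_zero.2 h02) (neg_pos.2 (div_neg_of_neg_of_pos hw h))] with ε hε
    exact sub_neg.1 (neg_pos.1 hε)

theorem exists_Ioo_prod_subset {s : Set (ℝ × ℝ)} (hs : s ∈ 𝓝 (0 : ℝ × ℝ)) :
    ∃ δ > 0, ∀ q : ℝ × ℝ, q.1 ∈ Ioo (-δ) δ → q.2 ∈ Ioo (-δ) δ → q ∈ s := by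
  obtain ⟨δ, hδ, h⟩ := Metric.mem_nhds_iff.1 hs
  refine ⟨δ, hδ, fun q h1 h2 => h ?_⟩
  rw [mem_ball_zero_iff, Prod.norm_def, max_lt_iff]
  exact ⟨abs_lt.2 h1, abs_lt.2 h2⟩

/-- A chart box around a point `p` in which a set `I` is contained in one or both of the axes. -/
theorem exists_chart_box (hα : ContDiff ℝ (⊤ : ℕ∞) α) (hβ : ContDiff ℝ (⊤ : ℕ∞) β) {p : ℂ}
    (hα0 : α 0 = p) (hβ0 : β 0 = p) (hdet : 0 < planeDet (deriv α 0) (deriv β 0))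
    (I : Set ℂ) (B : Prop) (H : ∀ δ > 0, ∀ᶠ z in 𝓝 p, z ∈ I →
      ∃ s : ℝ, |s| < δ ∧ (z = α s ∨ (B ∧ z = β s))) :
    ∃ δ > 0, (∀ q : ℝ × ℝ, q.1 ∈ Ioo (-δ) δ → q.2 ∈ Ioo (-δ) δ →
        0 < planeDet (deriv α q.1) (deriv β q.2) ∧
        (crossChart α β p q ∈ I → q.2 = 0 ∨ (B ∧ q.1 = 0))) ∧
      ∀ᶠ z in 𝓝 p, ∃ q : ℝ × ℝ, q.1 ∈ Ioo (-δ) δ ∧ q.2 ∈ Ioo (-δ) δ ∧ crossChart α β p q = z := by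
  have hst := hasStrictFDerivAt_crossChart hα hβ p 0 hdet.ne'
  have h0 : crossChart α β p 0 = p := by simp [crossChart, hα0, hβ0]
  let e := hst.toOpenPartialHomeomorph
  have he : ∀ q, e q = crossChart α β p q := fun q => rfl
  obtain ⟨δ₁, hδ₁, h1⟩ := exists_Ioo_prod_subset
    (e.open_source.mem_nhds hst.mem_toOpenPartialHomeomorph_source)
  have hdetc : ∀ᶠ q in 𝓝 (0 : ℝ × ℝ), 0 < planeDet (deriv α q.1) (deriv β q.2) := by
    have hc1 := continuous_deriv_of_contDiff hα
    have hc2 := continuous_deriv_of_contDiff hβ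
    have : Continuous fun q : ℝ × ℝ => planeDet (deriv α q.1) (deriv β q.2) := by
      unfold planeDet
      fun_prop
    exact this.continuousAt.eventually (lt_mem_nhds hdet)
  -- The bound `δ₁` keeps `(s, 0)` and `(0, s)` in the domain where the chart is injective. A point
  -- equal to `α s` or `β s` can then only have these coordinates, so it lies on an axis.
  have hHc : ∀ᶠ q in 𝓝 (0 : ℝ × ℝ), crossChart α β p q ∈ I →
      ∃ s : ℝ, |s| < δ₁ ∧ (crossChart α β p q = α s ∨ (B ∧ crossChart α β p q = β s)) := by
    have := hst.hasFDerivAt.continuousAt.tendsto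
    rw [h0] at this
    exact this.eventually (H δ₁ hδ₁)
  obtain ⟨δ₂, hδ₂, h2⟩ := exists_Ioo_prod_subset (hdetc.and hHc)
  have hle : Ioo (-min δ₁ δ₂) (min δ₁ δ₂) ⊆ Ioo (-δ₁) δ₁ :=
    Ioo_subset_Ioo (neg_le_neg (min_le_left _ _)) (min_le_left _ _)
  have hle' : Ioo (-min δ₁ δ₂) (min δ₁ δ₂) ⊆ Ioo (-δ₂) δ₂ :=
    Ioo_subset_Ioo (neg_le_neg (min_le_right _ _)) (min_le_right _ _)
  have hmin : 0 < min δ₁ δ₂ := lt_min hδ₁ hδ₂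
  refine ⟨min δ₁ δ₂, hmin, fun q hq1 hq2 => ?_, ?_⟩
  · obtain ⟨hd, hI⟩ := h2 q (hle' hq1) (hle' hq2)
    refine ⟨hd, fun hqI => ?_⟩
    obtain ⟨s, hs, hz⟩ := hI hqI
    have hq := h1 q (hle hq1) (hle hq2)
    have h0mem : (0 : ℝ) ∈ Ioo (-δ₁) δ₁ := ⟨neg_lt_zero.2 hδ₁, hδ₁⟩
    rcases hz with hz | ⟨hB, hz⟩
    · left
      have := e.injOn hq (h1 (s, 0) (abs_lt.1 hs) h0mem)
        (by rw [he, he, hz]; simp [crossChart, hβ0])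
      rw [this]
    · right
      have := e.injOn hq (h1 (0, s) h0mem (abs_lt.1 hs))
        (by rw [he, he, hz]; simp [crossChart, hα0])
      exact ⟨hB, by rw [this]⟩
  · have hopen : Ioo (-min δ₁ δ₂) (min δ₁ δ₂) ×ˢ Ioo (-min δ₁ δ₂) (min δ₁ δ₂) ∈ 𝓝 (0 : ℝ × ℝ) :=
      prod_mem_nhds (Ioo_mem_nhds (neg_lt_zero.2 hmin) hmin) (Ioo_mem_nhds (neg_lt_zero.2 hmin) hmin)
    have hmap := hst.map_nhds_eq_of_equiv
    rw [h0] at hmap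
    rw [← hmap]
    filter_upwards [image_mem_map hopen] with z hz
    obtain ⟨q, hq, rfl⟩ := hz
    exact ⟨q, hq.1, hq.2, rfl⟩

end Chart

theorem planeDet_self_I_mul {a : ℂ} (h : a ≠ 0) : 0 < planeDet a (Complex.I * a) := by
  have : planeDet a (Complex.I * a) = Complex.normSq a := by
    simp [planeDet, Complex.normSq_apply]
  rw [this]
  exact Complex.normSq_pos.2 h

theorem planeDet_neg_left (a b : ℂ) : planeDet (-a) b = -planeDet a b := by
  simp [planeDet]; ring

theorem planeDet_neg_right (a b : ℂ) : planeDet a (-b) = -planeDet a b := by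
  simp [planeDet]; ring

theorem planeDet_add_left (a b c : ℂ) : planeDet (a + b) c = planeDet a c + planeDet b c := by
  simp [planeDet]; ring

theorem planeDet_add_right (a b c : ℂ) : planeDet a (b + c) = planeDet a b + planeDet a c := by
  simp [planeDet]; ring

theorem planeDet_self (a : ℂ) : planeDet a a = 0 := by
  simp [planeDet]; ring

theorem planeDet_swap (a b : ℂ) : planeDet a b = -planeDet b a := by
  simp [planeDet]; ring

theorem planeDet_ne_zero_of_linearIndependent {a b : ℂ} (h : LinearIndependent ℝ ![a, b]) :
    planeDet a b ≠ 0 := by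
  intro h0
  rw [LinearIndependent.pair_iff] at h
  have h0' : a.re * b.im - a.im * b.re = 0 := h0
  have h1 := h b.im (-a.im) (by
    apply Complex.ext
    · simp; linarith
    · simp; ring)
  have h2 := h b.re (-a.re) (by
    apply Complex.ext
    · simp; ring
    · simp; linarith)
  have ha : a = 0 := Complex.ext (neg_eq_zero.1 h2.2) (neg_eq_zero.1 h1.2)
  exact one_ne_zero (h 1 0 (by simp [ha])).1

/-! ### The projection near an arc and near a crossing. -/

/-- The strand with parameter `t` modulo `1`. -/
noncomputable def strandAt {l : ℕ} (i : Fin l) (t : ℝ) : Strand l :=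
  (i, ⟨Int.fract t, Int.fract_nonneg t, Int.fract_lt_one t⟩)

theorem strandAt_self {l : ℕ} (q : Strand l) : strandAt q.1 q.2 = q :=
  Prod.ext rfl (Subtype.ext (Int.fract_eq_self.2 ⟨q.2.2.1, q.2.2.2⟩))

theorem eq_add_int_of_strandAt_eq {l : ℕ} {i j : Fin l} {t s : ℝ} (h : strandAt i t = strandAt j s) :
    i = j ∧ ∃ n : ℤ, t = s + n := by
  refine ⟨(Prod.ext_iff.1 h).1, ?_⟩
  have h1 : Int.fract t = Int.fract s := Subtype.ext_iff.1 (Prod.ext_iff.1 h).2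
  obtain ⟨n, hn⟩ := Int.fract_eq_fract.1 h1
  exact ⟨n, by linarith⟩

namespace LinkProjection

variable {l : ℕ} (P : LinkProjection l) {A : Ambient}

theorem curve_add_int (i : Fin l) (t : ℝ) (n : ℤ) : P.curve i (t + n) = P.curve i t := by
  simpa using (P.periodic i).int_mul n t

theorem strandPoint_strandAt (i : Fin l) (t : ℝ) :
    strandPoint P.curve (strandAt i t) = P.curve i t := by
  have := P.curve_add_int i (Int.fract t) ⌊t⌋
  rw [Int.fract_add_floor] at this
  exact this.symm

theorem strandTangent_strandAt (i : Fin l) (t : ℝ) :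
    strandTangent P.curve (strandAt i t) = deriv (P.curve i) t := by
  have := (periodic_deriv (P.periodic i)).int_mul ⌊t⌋ (Int.fract t)
  rw [mul_one, Int.fract_add_floor] at this
  exact this.symm

theorem deriv_curve_const_add (i : Fin l) (t s : ℝ) :
    deriv (fun x => P.curve i (t + x)) s = deriv (P.curve i) (t + s) :=
  deriv_comp_const_add _ _ _

theorem contDiff_curve_const_add (i : Fin l) (t : ℝ) :
    ContDiff ℝ (⊤ : ℕ∞) (fun x => P.curve i (t + x)) :=
  (P.smooth i).comp (contDiff_const.add contDiff_id)

variable {P}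

theorem eq_of_curve_eq_of_notMem_crossings {i j : Fin l} {t s : ℝ} (h : P.curve i t ∉ P.crossings)
    (e : P.curve j s = P.curve i t) : j = i ∧ ∃ n : ℤ, s = t + n := by
  refine eq_add_int_of_strandAt_eq ?_
  by_contra hne
  exact h ⟨_, _, hne, (P.strandPoint_strandAt j s).trans e, P.strandPoint_strandAt i t⟩

variable (P)

/-- Near a point `p`, the image of the curves consists of short pieces of the strands
through `p`. -/
theorem eventually_mem_image_imp (T : Set (Fin l × ℝ)) {p : ℂ}
    (hT : ∀ j t, P.curve j t = p → ∃ x ∈ T, j = x.1 ∧ ∃ n : ℤ, t = x.2 + n) {δ : ℝ} (hδ : 0 < δ) :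
    ∀ᶠ z in 𝓝 p, z ∈ P.image → ∃ x ∈ T, ∃ s : ℝ, |s| < δ ∧ z = P.curve x.1 (x.2 + s) := by
  -- `N j` collects the parameters within `δ` of a passage through `p`, modulo `1`. The other
  -- parameters in `[0, 1]` form a compact set whose image misses a neighbourhood of `p`.
  let N : Fin l → Set ℝ := fun j => ⋃ x ∈ {x ∈ T | x.1 = j}, ⋃ n : ℤ, {t | |t - x.2 - n| < δ}
  have hN : ∀ j, IsOpen (N j) := fun j => isOpen_biUnion fun x _ => isOpen_iUnion fun n =>
    isOpen_lt (by fun_prop) continuous_const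
  have hnear : ∀ᶠ z in 𝓝 p, ∀ j, z ∉ P.curve j '' (Icc 0 1 \ N j) := by
    refine eventually_all.2 fun j => ?_
    have hK : IsCompact (Icc (0 : ℝ) 1 \ N j) := isCompact_Icc.diff (hN j)
    refine (hK.image (P.smooth j).continuous).isClosed.isOpen_compl.mem_nhds ?_
    rintro ⟨t, ⟨-, htN⟩, e⟩
    obtain ⟨x, hx, rfl, n, hn⟩ := hT j t e
    refine htN (mem_biUnion (x := x) ⟨hx, rfl⟩ (mem_iUnion.2 ⟨n, ?_⟩))
    simp [hn, hδ]
  filter_upwards [hnear] with z hz hzi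
  obtain ⟨j, t, rfl⟩ := P.mem_image_iff.1 hzi
  have hft : P.curve j (Int.fract t) = P.curve j t := P.strandPoint_strandAt j t
  have hmem : Int.fract t ∈ N j := by
    by_contra hmem
    exact hz j ⟨Int.fract t, ⟨⟨Int.fract_nonneg t, (Int.fract_lt_one t).le⟩, hmem⟩, hft⟩
  obtain ⟨x, ⟨hx, rfl⟩, hmem'⟩ := mem_iUnion₂.1 hmem
  obtain ⟨n, hn⟩ := mem_iUnion.1 hmem'
  refine ⟨x, hx, _, hn, ?_⟩
  have h1 := P.curve_add_int x.1 (x.2 + (Int.fract t - x.2 - n)) n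
  rw [← h1, ← hft]
  congr 1
  ring

variable {P}

/-- `L` lies on the left and `R` on the right of the `i`-th curve at the parameter `t`. -/
def IsSidePair (L R : P.Region A) (i : Fin l) (t : ℝ) : Prop :=
  L.LiesAt (P.curve i t) (Complex.I * deriv (P.curve i) t) ∧
    R.LiesAt (P.curve i t) (-(Complex.I * deriv (P.curve i) t))

/-- The determinants are, up to a positive factor, the coordinates of `w` in the frame at `q`. Only
their signs matter, and a zero coordinate imposes no condition on the corresponding chart
coordinate. -/
theorem Region.liesAt_of_chart {α β : ℝ → ℂ} (hα : ContDiff ℝ (⊤ : ℕ∞) α)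
    (hβ : ContDiff ℝ (⊤ : ℕ∞) β) {p : ℂ} {q : ℝ × ℝ}
    (h : 0 < planeDet (deriv α q.1) (deriv β q.2)) {w : ℂ} {R : P.Region A}
    (hV : ∀ᶠ x in 𝓝 q, (0 < planeDet w (deriv β q.2) → q.1 < x.1) →
      (planeDet w (deriv β q.2) < 0 → x.1 < q.1) → (0 < planeDet (deriv α q.1) w → q.2 < x.2) →
      (planeDet (deriv α q.1) w < 0 → x.2 < q.2) → crossChart α β p x ∈ R.finitePart) :
    R.LiesAt (crossChart α β p q) w := by
  obtain ⟨X, hX, he, h1, h2, h3, h4⟩ := exists_chart_path hα hβ p q h w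
  rw [← eventually_imp_distrib_left] at h1 h2 h3 h4
  filter_upwards [hX.eventually hV, he, h1, h2, h3, h4] with ε hε e h1 h2 h3 h4
  rw [← e]
  exact hε h1 h2 h3 h4

theorem Region.exists_image_subset {α β : ℝ → ℂ} (hα : ContDiff ℝ (⊤ : ℕ∞) α)
    (hβ : ContDiff ℝ (⊤ : ℕ∞) β) {p : ℂ} {V : Set (ℝ × ℝ)} (hV : Convex ℝ V) (hne : V.Nonempty)
    (hP : ∀ q ∈ V, crossChart α β p q ∉ P.image) :
    ∃ R : P.Region A, ∀ q ∈ V, crossChart α β p q ∈ R.finitePart := by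
  obtain ⟨q₀, hq₀⟩ := hne
  obtain ⟨R, hR⟩ := Region.exists_mem (A := A) (hP q₀ hq₀)
  have hcont : Continuous (crossChart α β p) := by
    have h1 := hα.continuous
    have h2 := hβ.continuous
    unfold crossChart
    fun_prop
  have hsub := Region.subset_finitePart (hV.isPreconnected.image _ hcont.continuousOn)
    (by rintro _ ⟨q, hq, rfl⟩; exact hP q hq) hR ⟨q₀, hq₀, rfl⟩
  exact ⟨R, fun q hq => hsub ⟨q, hq, rfl⟩⟩

/-- In the chart formed by the curve and a straight normal line, the image is the horizontal axis,
and the two half boxes lie in one region each. The same pair serves all nearby parameters, which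
makes jumps locally constant. -/
theorem exists_arc_sides (A : Ambient) {i : Fin l} {t : ℝ} (h : P.curve i t ∉ P.crossings) :
    ∃ L R : P.Region A,
      (∀ᶠ z in 𝓝 (P.curve i t), z ∉ P.image → z ∈ L.finitePart ∨ z ∈ R.finitePart) ∧
      ∀ᶠ s in 𝓝 t, IsSidePair L R i s := by
  set p := P.curve i t with hp
  set v := deriv (P.curve i) t with hv
  set α : ℝ → ℂ := fun s => P.curve i (t + s) with hαdef
  set β : ℝ → ℂ := fun s => p + s * (Complex.I * v) with hβdef
  have hα : ContDiff ℝ (⊤ : ℕ∞) α := P.contDiff_curve_const_add i t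
  have hβ : ContDiff ℝ (⊤ : ℕ∞) β :=
    contDiff_const.add (Complex.ofRealCLM.contDiff.mul contDiff_const)
  have hα' : ∀ s, deriv α s = deriv (P.curve i) (t + s) := P.deriv_curve_const_add i t
  have hβ' : ∀ s, deriv β s = Complex.I * v := fun s => by
    have := ((Complex.ofRealCLM.hasDerivAt (x := s)).mul_const (Complex.I * v)).const_add p
    rw [Complex.ofRealCLM_apply, Complex.ofReal_one, one_mul] at this
    exact this.deriv
  have hβ0 : β 0 = p := by simp [hβdef]
  obtain ⟨δ, hδ, hbox, hnear⟩ := exists_chart_box hα hβ (p := p) (by simp [hαdef, hp]) hβ0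
    (by rw [hα', hβ', add_zero]; exact planeDet_self_I_mul (P.immersed i t)) P.image False
    (by
      intro δ hδ
      filter_upwards [P.eventually_mem_image_imp {(i, t)} (p := p) (fun j s e =>
        ⟨_, rfl, eq_of_curve_eq_of_notMem_crossings h e⟩) hδ] with z hz hzi
      obtain ⟨x, rfl, s, hs, e⟩ := hz hzi
      exact ⟨s, hs, Or.inl e⟩)
  have hchart0 : ∀ x, crossChart α β p (x, 0) = P.curve i (t + x) := fun x => by
    simp [crossChart, hβ0, hαdef]
  have hmid : δ / 2 ∈ Ioo 0 δ := ⟨by linarith, by linarith⟩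
  have hmid' : -(δ / 2) ∈ Ioo (-δ) 0 := ⟨by linarith, by linarith⟩
  have hzero : (0 : ℝ) ∈ Ioo (-δ) δ := ⟨neg_lt_zero.2 hδ, hδ⟩
  have hup : Ioo 0 δ ⊆ Ioo (-δ) δ := Ioo_subset_Ioo_left (by linarith)
  have hdown : Ioo (-δ) 0 ⊆ Ioo (-δ) δ := Ioo_subset_Ioo_right hδ.le
  obtain ⟨L, hL⟩ := Region.exists_image_subset (A := A) hα hβ (p := p)
    (V := Ioo (-δ) δ ×ˢ Ioo 0 δ) ((convex_Ioo _ _).prod (convex_Ioo _ _)) ⟨(0, δ / 2), hzero, hmid⟩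
    (fun q hq hqi => by
      rcases (hbox q hq.1 (hup hq.2)).2 hqi with h0 | h0
      · exact hq.2.1.ne' h0
      · exact h0.1)
  obtain ⟨R, hR⟩ := Region.exists_image_subset (A := A) hα hβ (p := p)
    (V := Ioo (-δ) δ ×ˢ Ioo (-δ) 0) ((convex_Ioo _ _).prod (convex_Ioo _ _))
    ⟨(0, -(δ / 2)), hzero, hmid'⟩
    (fun q hq hqi => by
      rcases (hbox q hq.1 (hdown hq.2)).2 hqi with h0 | h0
      · exact hq.2.2.ne h0
      · exact h0.1)
  refine ⟨L, R, ?_, ?_⟩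
  · filter_upwards [hnear] with z hz hzi
    obtain ⟨⟨x, y⟩, hx, hy, rfl⟩ := hz
    rcases lt_trichotomy y 0 with hlt | rfl | hlt
    · exact Or.inr (hR (x, y) ⟨hx, hy.1, hlt⟩)
    · exact absurd (hchart0 x ▸ P.mem_image_curve i _) hzi
    · exact Or.inl (hL (x, y) ⟨hx, hlt, hy.2⟩)
  · filter_upwards [Ioo_mem_nhds (sub_lt_self t hδ) (lt_add_of_pos_right t hδ)] with s hs
    have hx : s - t ∈ Ioo (-δ) δ := ⟨by linarith [hs.1], by linarith [hs.2]⟩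
    have hst : t + (s - t) = s := by ring
    have hdet := (hbox (s - t, 0) hx hzero).1
    have hpt : crossChart α β p (s - t, 0) = P.curve i s := by rw [hchart0, hst]
    have hder : deriv α (s - t) = deriv (P.curve i) s := by rw [hα', hst]
    have hnb : ∀ᶠ x : ℝ × ℝ in 𝓝 (s - t, 0), x ∈ Ioo (-δ) δ ×ˢ Ioo (-δ) δ :=
      (isOpen_Ioo.prod isOpen_Ioo).mem_nhds ⟨hx, hzero⟩
    have hI := planeDet_self_I_mul (P.immersed i s)
    constructor
    · rw [← hpt]
      refine Region.liesAt_of_chart hα hβ hdet ?_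
      filter_upwards [hnb] with x hx _ _ h3 _
      exact hL x ⟨hx.1, h3 (by rw [hder]; exact hI), hx.2.2⟩
    · rw [← hpt]
      refine Region.liesAt_of_chart hα hβ hdet ?_
      filter_upwards [hnb] with x hx _ _ _ h4
      exact hR x ⟨hx.1, hx.2.1, h4 (by rw [hder, planeDet_neg_right]; exact neg_neg_of_pos hI)⟩

/-- `Q₁, Q₂, Q₃, Q₄` are the regions at the four corners of the crossing `x` of the positively
ordered strands `q` and `q'`, in counterclockwise order starting between the two velocities. -/
structure CrossingCorners (x : ℂ) (q q' : Strand l) (Q₁ Q₂ Q₃ Q₄ : P.Region A) : Prop where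
  ne : q ≠ q'
  point : strandPoint P.curve q = x
  point' : strandPoint P.curve q' = x
  det_pos : 0 < planeDet (strandTangent P.curve q) (strandTangent P.curve q')
  near : ∀ᶠ z in 𝓝 x, z ∉ P.image →
    z ∈ Q₁.finitePart ∨ z ∈ Q₂.finitePart ∨ z ∈ Q₃.finitePart ∨ z ∈ Q₄.finitePart
  lies₁ : Q₁.LiesAt x (strandTangent P.curve q + strandTangent P.curve q')
  lies₂ : Q₂.LiesAt x (-strandTangent P.curve q + strandTangent P.curve q')
  lies₃ : Q₃.LiesAt x (-strandTangent P.curve q + -strandTangent P.curve q')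
  lies₄ : Q₄.LiesAt x (strandTangent P.curve q + -strandTangent P.curve q')
  after : ∀ᶠ s in 𝓝[>] (q.2 : ℝ), IsSidePair Q₁ Q₄ q.1 s
  before : ∀ᶠ s in 𝓝[<] (q.2 : ℝ), IsSidePair Q₂ Q₃ q.1 s
  after' : ∀ᶠ s in 𝓝[>] (q'.2 : ℝ), IsSidePair Q₂ Q₁ q'.1 s
  before' : ∀ᶠ s in 𝓝[<] (q'.2 : ℝ), IsSidePair Q₃ Q₄ q'.1 s

theorem eventually_nhdsGT_of_pos {p : ℝ → Prop} {t δ : ℝ} (hδ : 0 < δ)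
    (h : ∀ u ∈ Ioo 0 δ, p (t + u)) : ∀ᶠ s in 𝓝[>] t, p s := by
  filter_upwards [Ioo_mem_nhdsGT (lt_add_of_pos_right t hδ)] with s hs
  have := h (s - t) ⟨by linarith [hs.1], by linarith [hs.2]⟩
  rwa [add_sub_cancel] at this

theorem eventually_nhdsLT_of_neg {p : ℝ → Prop} {t δ : ℝ} (hδ : 0 < δ)
    (h : ∀ u ∈ Ioo (-δ) 0, p (t + u)) : ∀ᶠ s in 𝓝[<] t, p s := by
  filter_upwards [Ioo_mem_nhdsLT (sub_lt_self t hδ)] with s hs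
  have := h (s - t) ⟨by linarith [hs.1], by linarith [hs.2]⟩
  rwa [add_sub_cancel] at this

/-- The two strands are the axes of a chart, since by `double` no third strand passes through `x`.
Each open quadrant of the box is connected and off the image, hence lies in one region. -/
theorem exists_crossingCorners_of_det_pos (A : Ambient) {x : ℂ} {q q' : Strand l} (hne : q ≠ q')
    (hq : strandPoint P.curve q = x) (hq' : strandPoint P.curve q' = x)
    (hdet : 0 < planeDet (strandTangent P.curve q) (strandTangent P.curve q')) :
    ∃ Q₁ Q₂ Q₃ Q₄ : P.Region A, CrossingCorners x q q' Q₁ Q₂ Q₃ Q₄ := by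
  set α : ℝ → ℂ := fun s => P.curve q.1 (q.2 + s) with hαdef
  set β : ℝ → ℂ := fun s => P.curve q'.1 (q'.2 + s) with hβdef
  have hα : ContDiff ℝ (⊤ : ℕ∞) α := P.contDiff_curve_const_add q.1 q.2
  have hβ : ContDiff ℝ (⊤ : ℕ∞) β := P.contDiff_curve_const_add q'.1 q'.2
  have hα' : ∀ s, deriv α s = deriv (P.curve q.1) (q.2 + s) := P.deriv_curve_const_add q.1 q.2
  have hβ' : ∀ s, deriv β s = deriv (P.curve q'.1) (q'.2 + s) :=
    P.deriv_curve_const_add q'.1 q'.2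
  have hα0 : α 0 = x := by rw [← hq]; simp [hαdef, strandPoint]
  have hβ0 : β 0 = x := by rw [← hq']; simp [hβdef, strandPoint]
  have hαd : deriv α 0 = strandTangent P.curve q := by rw [hα', add_zero]; rfl
  have hβd : deriv β 0 = strandTangent P.curve q' := by rw [hβ', add_zero]; rfl
  have hT : ∀ j t, P.curve j t = x →
      ∃ y ∈ ({(q.1, (q.2 : ℝ)), (q'.1, (q'.2 : ℝ))} : Set (Fin l × ℝ)),
        j = y.1 ∧ ∃ n : ℤ, t = y.2 + n := by
    intro j t e
    have e' := (P.strandPoint_strandAt j t).trans e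
    rcases P.double (strandAt j t) q q' (e'.trans hq.symm) (hq.trans hq'.symm) with h | h | h
    · rw [← strandAt_self q] at h
      exact ⟨_, Or.inl rfl, eq_add_int_of_strandAt_eq h⟩
    · exact absurd h hne
    · rw [← strandAt_self q'] at h
      exact ⟨_, Or.inr rfl, eq_add_int_of_strandAt_eq h⟩
  obtain ⟨δ, hδ, hbox, hnear⟩ := exists_chart_box hα hβ (p := x) hα0 hβ0
    (by rw [hαd, hβd]; exact hdet) P.image True
    (by
      intro δ hδ
      filter_upwards [P.eventually_mem_image_imp _ hT hδ] with z hz hzi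
      obtain ⟨y, rfl | rfl, s, hs, e⟩ := hz hzi
      · exact ⟨s, hs, Or.inl e⟩
      · exact ⟨s, hs, Or.inr ⟨trivial, e⟩⟩)
  have hchartα : ∀ u, crossChart α β x (u, 0) = P.curve q.1 (q.2 + u) := fun u => by
    simp [crossChart, hβ0, hαdef]
  have hchartβ : ∀ u, crossChart α β x (0, u) = P.curve q'.1 (q'.2 + u) := fun u => by
    simp [crossChart, hα0, hβdef]
  have hmid : δ / 2 ∈ Ioo 0 δ := ⟨by linarith, by linarith⟩
  have hmid' : -(δ / 2) ∈ Ioo (-δ) 0 := ⟨by linarith, by linarith⟩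
  have hzero : (0 : ℝ) ∈ Ioo (-δ) δ := ⟨neg_lt_zero.2 hδ, hδ⟩
  have hup : Ioo 0 δ ⊆ Ioo (-δ) δ := Ioo_subset_Ioo_left (by linarith)
  have hdown : Ioo (-δ) 0 ⊆ Ioo (-δ) δ := Ioo_subset_Ioo_right hδ.le
  have hquad : ∀ J K : Set ℝ, (J = Ioo 0 δ ∨ J = Ioo (-δ) 0) → (K = Ioo 0 δ ∨ K = Ioo (-δ) 0) →
      ∃ R : P.Region A, ∀ y ∈ J ×ˢ K, crossChart α β x y ∈ R.finitePart := by
    have hJ : ∀ J : Set ℝ, (J = Ioo 0 δ ∨ J = Ioo (-δ) 0) →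
        Convex ℝ J ∧ J.Nonempty ∧ J ⊆ Ioo (-δ) δ ∧ ∀ y ∈ J, y ≠ 0 := by
      rintro J (rfl | rfl)
      · exact ⟨convex_Ioo _ _, ⟨_, hmid⟩, hup, fun y hy => hy.1.ne'⟩
      · exact ⟨convex_Ioo _ _, ⟨_, hmid'⟩, hdown, fun y hy => hy.2.ne⟩
    intro J K h1 h2
    obtain ⟨c1, n1, s1, z1⟩ := hJ J h1
    obtain ⟨c2, n2, s2, z2⟩ := hJ K h2
    refine Region.exists_image_subset hα hβ (c1.prod c2) (n1.prod n2) fun y hy hyi => ?_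
    rcases (hbox y (s1 hy.1) (s2 hy.2)).2 hyi with h0 | h0
    · exact z2 _ hy.2 h0
    · exact z1 _ hy.1 h0.2
  obtain ⟨Q₁, h₁⟩ := hquad _ _ (Or.inl rfl) (Or.inl rfl)
  obtain ⟨Q₂, h₂⟩ := hquad _ _ (Or.inr rfl) (Or.inl rfl)
  obtain ⟨Q₃, h₃⟩ := hquad _ _ (Or.inr rfl) (Or.inr rfl)
  obtain ⟨Q₄, h₄⟩ := hquad _ _ (Or.inl rfl) (Or.inr rfl)
  have hnb : ∀ y : ℝ × ℝ, y.1 ∈ Ioo (-δ) δ → y.2 ∈ Ioo (-δ) δ →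
      ∀ᶠ y' in 𝓝 y, y' ∈ Ioo (-δ) δ ×ˢ Ioo (-δ) δ := fun y h1 h2 =>
    (isOpen_Ioo.prod isOpen_Ioo).mem_nhds ⟨h1, h2⟩
  have hcenter : crossChart α β x (0, 0) = x := by simp [crossChart, hα0, hβ0]
  have hdet0 : 0 < planeDet (deriv α (0, (0 : ℝ)).1) (deriv β ((0 : ℝ), 0).2) := by
    rw [hαd, hβd]; exact hdet
  -- The normal to the strand need not follow the second axis, so the first coordinate may drift; it
  -- stays in the neighbourhood `J`, while the second takes the sign of the side.
  have hα_side : ∀ u ∈ Ioo (-δ) δ, ∀ J : Set ℝ, J ∈ 𝓝 u → ∀ L R : P.Region A,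
      (∀ y ∈ J ×ˢ Ioo 0 δ, crossChart α β x y ∈ L.finitePart) →
      (∀ y ∈ J ×ˢ Ioo (-δ) 0, crossChart α β x y ∈ R.finitePart) →
      IsSidePair L R q.1 (q.2 + u) := by
    intro u hu J hJ L R hL hR
    have hd := (hbox (u, 0) hu hzero).1
    have hI := planeDet_self_I_mul (P.immersed q.1 (q.2 + u))
    have hJ' : ∀ᶠ y : ℝ × ℝ in 𝓝 (u, 0), y.1 ∈ J := continuousAt_fst.eventually hJ
    unfold IsSidePair
    rw [← hchartα, ← hα']
    rw [← hα'] at hI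
    constructor
    · refine Region.liesAt_of_chart hα hβ hd ?_
      filter_upwards [hnb _ hu hzero, hJ'] with y hy hyJ _ _ h3 _
      exact hL y ⟨hyJ, h3 hI, hy.2.2⟩
    · refine Region.liesAt_of_chart hα hβ hd ?_
      filter_upwards [hnb _ hu hzero, hJ'] with y hy hyJ _ _ _ h4
      exact hR y ⟨hyJ, hy.2.1, h4 (by rw [planeDet_neg_right]; exact neg_neg_of_pos hI)⟩
  have hβ_side : ∀ u ∈ Ioo (-δ) δ, ∀ J : Set ℝ, J ∈ 𝓝 u → ∀ L R : P.Region A,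
      (∀ y ∈ Ioo (-δ) 0 ×ˢ J, crossChart α β x y ∈ L.finitePart) →
      (∀ y ∈ Ioo 0 δ ×ˢ J, crossChart α β x y ∈ R.finitePart) →
      IsSidePair L R q'.1 (q'.2 + u) := by
    intro u hu J hJ L R hL hR
    have hd := (hbox (0, u) hzero hu).1
    have hI := planeDet_self_I_mul (P.immersed q'.1 (q'.2 + u))
    have hJ' : ∀ᶠ y : ℝ × ℝ in 𝓝 (0, u), y.2 ∈ J := continuousAt_snd.eventually hJ
    unfold IsSidePair
    rw [← hchartβ, ← hβ']
    rw [← hβ', planeDet_swap, neg_pos] at hI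
    constructor
    · refine Region.liesAt_of_chart hα hβ hd ?_
      filter_upwards [hnb _ hzero hu, hJ'] with y hy hyJ _ h2 _ _
      exact hL y ⟨⟨hy.1.1, h2 hI⟩, hyJ⟩
    · refine Region.liesAt_of_chart hα hβ hd ?_
      filter_upwards [hnb _ hzero hu, hJ'] with y hy hyJ h1 _ _ _
      exact hR y ⟨⟨h1 (by rw [planeDet_neg_left]; exact neg_pos.2 hI), hy.1.2⟩, hyJ⟩
  refine ⟨Q₁, Q₂, Q₃, Q₄, hne, hq, hq', hdet, ?_, ?_, ?_, ?_, ?_, ?_, ?_, ?_, ?_⟩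
  · filter_upwards [hnear] with z hz hzi
    obtain ⟨⟨a, b⟩, ha, hb, rfl⟩ := hz
    have ha0 : a ≠ 0 := by
      rintro rfl
      exact hzi (hchartβ b ▸ P.mem_image_curve _ _)
    have hb0 : b ≠ 0 := by
      rintro rfl
      exact hzi (hchartα a ▸ P.mem_image_curve _ _)
    rcases lt_or_gt_of_ne ha0 with ha0 | ha0 <;> rcases lt_or_gt_of_ne hb0 with hb0 | hb0
    · exact Or.inr (Or.inr (Or.inl (h₃ (a, b) ⟨⟨ha.1, ha0⟩, hb.1, hb0⟩)))
    · exact Or.inr (Or.inl (h₂ (a, b) ⟨⟨ha.1, ha0⟩, hb0, hb.2⟩))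
    · exact Or.inr (Or.inr (Or.inr (h₄ (a, b) ⟨⟨ha0, ha.2⟩, hb.1, hb0⟩)))
    · exact Or.inl (h₁ (a, b) ⟨⟨ha0, ha.2⟩, hb0, hb.2⟩)
  · rw [← hcenter]
    refine Region.liesAt_of_chart hα hβ hdet0 ?_
    rw [hαd, hβd]
    simp only [planeDet_add_left, planeDet_add_right, planeDet_self, add_zero, zero_add]
    filter_upwards [hnb _ hzero hzero] with y hy f1 f2 f3 f4
    exact h₁ y ⟨⟨f1 hdet, hy.1.2⟩, f3 hdet, hy.2.2⟩
  · rw [← hcenter]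
    refine Region.liesAt_of_chart hα hβ hdet0 ?_
    rw [hαd, hβd]
    simp only [planeDet_add_left, planeDet_add_right, planeDet_self, add_zero, zero_add,
      planeDet_neg_left, planeDet_neg_right, neg_zero, neg_lt_zero]
    filter_upwards [hnb _ hzero hzero] with y hy f1 f2 f3 f4
    exact h₂ y ⟨⟨hy.1.1, f2 hdet⟩, f3 hdet, hy.2.2⟩
  · rw [← hcenter]
    refine Region.liesAt_of_chart hα hβ hdet0 ?_
    rw [hαd, hβd]
    simp only [planeDet_add_left, planeDet_add_right, planeDet_self, add_zero, zero_add,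
      planeDet_neg_left, planeDet_neg_right, neg_zero, neg_lt_zero]
    filter_upwards [hnb _ hzero hzero] with y hy f1 f2 f3 f4
    exact h₃ y ⟨⟨hy.1.1, f2 hdet⟩, hy.2.1, f4 hdet⟩
  · rw [← hcenter]
    refine Region.liesAt_of_chart hα hβ hdet0 ?_
    rw [hαd, hβd]
    simp only [planeDet_add_left, planeDet_add_right, planeDet_self, add_zero, zero_add,
      planeDet_neg_left, planeDet_neg_right, neg_zero, neg_lt_zero]
    filter_upwards [hnb _ hzero hzero] with y hy f1 f2 f3 f4
    exact h₄ y ⟨⟨f1 hdet, hy.1.2⟩, hy.2.1, f4 hdet⟩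
  · exact eventually_nhdsGT_of_pos hδ fun u hu =>
      hα_side u (hup hu) _ (isOpen_Ioo.mem_nhds hu) _ _ h₁ h₄
  · exact eventually_nhdsLT_of_neg hδ fun u hu =>
      hα_side u (hdown hu) _ (isOpen_Ioo.mem_nhds hu) _ _ h₂ h₃
  · exact eventually_nhdsGT_of_pos hδ fun u hu =>
      hβ_side u (hup hu) _ (isOpen_Ioo.mem_nhds hu) _ _ h₂ h₁
  · exact eventually_nhdsLT_of_neg hδ fun u hu =>
      hβ_side u (hdown hu) _ (isOpen_Ioo.mem_nhds hu) _ _ h₃ h₄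

theorem exists_crossingCorners (A : Ambient) {x : ℂ} (hx : x ∈ P.crossings) :
    ∃ (q q' : Strand l) (Q₁ Q₂ Q₃ Q₄ : P.Region A), CrossingCorners x q q' Q₁ Q₂ Q₃ Q₄ := by
  obtain ⟨q, q', hne, hq, hq'⟩ := hx
  rcases lt_or_gt_of_ne
    (planeDet_ne_zero_of_linearIndependent (P.transverse q q' hne (hq.trans hq'.symm))) with h | h
  · rw [planeDet_swap, neg_lt_zero] at h
    exact ⟨q', q, exists_crossingCorners_of_det_pos A hne.symm hq' hq h⟩
  · exact ⟨q, q', exists_crossingCorners_of_det_pos A hne hq hq' h⟩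

theorem eventually_curve_notMem_crossings (P : LinkProjection l) (i : Fin l) (t : ℝ) :
    ∀ᶠ s in 𝓝[≠] t, P.curve i s ∉ P.crossings := by
  have h1 : ∀ᶠ s in 𝓝[≠] t, P.curve i s ≠ P.curve i t :=
    (hasDerivAt_of_contDiff (P.smooth i) t).eventually_ne (P.immersed i t)
  have h2 : ∀ᶠ z in 𝓝 (P.curve i t), z ∉ P.crossings \ {P.curve i t} :=
    (P.finite_multiplePoints.subset sdiff_subset).isClosed.isOpen_compl.mem_nhds (by simp)
  have h3 := nhdsWithin_le_nhds ((P.smooth i).continuous.continuousAt.eventually h2) (s := {t}ᶜ)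
  filter_upwards [h1, h3] with s hs hs' hc
  exact hs' ⟨hc, hs⟩

namespace CrossingCorners

variable {x : ℂ} {q q' : Strand l} {Q₁ Q₂ Q₃ Q₄ : P.Region A}

theorem exists_after (h : CrossingCorners x q q' Q₁ Q₂ Q₃ Q₄) :
    ∃ s, P.curve q.1 s ∉ P.crossings ∧ IsSidePair Q₁ Q₄ q.1 s :=
  (((P.eventually_curve_notMem_crossings _ _).filter_mono
    (nhdsWithin_mono (s := Ioi (q.2 : ℝ)) _ fun _ hs => LT.lt.ne' hs)).and h.after).exists

theorem exists_before (h : CrossingCorners x q q' Q₁ Q₂ Q₃ Q₄) :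
    ∃ s, P.curve q.1 s ∉ P.crossings ∧ IsSidePair Q₂ Q₃ q.1 s :=
  (((P.eventually_curve_notMem_crossings _ _).filter_mono
    (nhdsWithin_mono (s := Iio (q.2 : ℝ)) _ fun _ hs => LT.lt.ne hs)).and h.before).exists

theorem exists_after' (h : CrossingCorners x q q' Q₁ Q₂ Q₃ Q₄) :
    ∃ s, P.curve q'.1 s ∉ P.crossings ∧ IsSidePair Q₂ Q₁ q'.1 s :=
  (((P.eventually_curve_notMem_crossings _ _).filter_mono
    (nhdsWithin_mono (s := Ioi (q'.2 : ℝ)) _ fun _ hs => LT.lt.ne' hs)).and h.after').exists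

theorem exists_before' (h : CrossingCorners x q q' Q₁ Q₂ Q₃ Q₄) :
    ∃ s, P.curve q'.1 s ∉ P.crossings ∧ IsSidePair Q₃ Q₄ q'.1 s :=
  (((P.eventually_curve_notMem_crossings _ _).filter_mono
    (nhdsWithin_mono (s := Iio (q'.2 : ℝ)) _ fun _ hs => LT.lt.ne hs)).and h.before').exists

end CrossingCorners

/-! ### Winding numbers of regions, and passage from local to global. -/

/-- The winding number of the `j`-th curve around the points of a region. -/
noncomputable def Region.winding (R : P.Region A) (j : Fin l) : ℤ :=
  windingNumber (P.curve j) R.nonempty_finitePart.some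

theorem Region.winding_eq {R : P.Region A} {z : ℂ} (hz : z ∈ R.finitePart) (j : Fin l) :
    R.winding j = windingNumber (P.curve j) z := by
  obtain ⟨r, hr⟩ := exists_windingNumber_eq_zero (P.smooth j) (P.periodic j)
  refine R.eq_of_locally_constant (fun z hz => ?_) hr R.nonempty_finitePart.some_mem hz
  exact eventually_windingNumber_eq (P.smooth j) (P.periodic j)
    fun t e => hz (e ▸ P.mem_image_curve j t)

theorem tendsto_add_mul_nhdsGT (z w : ℂ) :
    Tendsto (fun ε : ℝ => z + ε * w) (𝓝[>] 0) (𝓝 z) := by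
  have : Continuous (fun ε : ℝ => z + ε * w) := by fun_prop
  simpa using (this.tendsto 0).mono_left nhdsWithin_le_nhds

theorem IsSidePair.winding_eq {L R : P.Region A} {i : Fin l} {t : ℝ} (h : IsSidePair L R i t)
    (ht : P.curve i t ∉ P.crossings) (j : Fin l) :
    L.winding j = R.winding j + if j = i then 1 else 0 := by
  split_ifs with hj
  · subst hj
    obtain ⟨ε, hε, h1, h2⟩ := ((eventually_windingNumber_jump (P.smooth j) (P.periodic j)
      (P.immersed j t) fun s e => (eq_of_curve_eq_of_notMem_crossings ht e).2).and
      (h.1.and h.2)).exists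
    rw [Region.winding_eq h1, Region.winding_eq h2]
    exact hε (fun s e => Region.notMem_image h1 (e ▸ P.mem_image_curve j s))
      (fun s e => Region.notMem_image h2 (e ▸ P.mem_image_curve j s))
  · have hev := eventually_windingNumber_eq (P.smooth j) (P.periodic j) (z₀ := P.curve i t)
      fun s e => hj (eq_of_curve_eq_of_notMem_crossings ht e).1
    obtain ⟨ε, ⟨h1, e1⟩, h2, e2⟩ := ((h.1.and ((tendsto_add_mul_nhdsGT _ _).eventually hev)).and
      (h.2.and ((tendsto_add_mul_nhdsGT _ _).eventually hev))).exists
    rw [Region.winding_eq h1, Region.winding_eq h2, e1, e2, add_zero]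

theorem IsAlexanderNumbering.eq_add_one {a : P.Region A → ℤ} (ha : IsAlexanderNumbering a)
    {i : Fin l} {t : ℝ} (ht : P.curve i t ∉ P.crossings) {L R : P.Region A}
    (h : IsSidePair L R i t) : a L = a R + 1 := by
  refine ha (strandAt i t) ?_ L R ?_ ?_
  · rwa [strandPoint_strandAt]
  · rw [strandPoint_strandAt, strandTangent_strandAt]
    exact h.1
  · rw [strandPoint_strandAt, strandTangent_strandAt]
    exact h.2

theorem Region.LiesAt.frequently_notMem_image {R : P.Region A} {z w : ℂ} (h : R.LiesAt z w) :
    ∃ᶠ z' in 𝓝 z, z' ∉ P.image :=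
  (tendsto_add_mul_nhdsGT z w).frequently
    (Eventually.frequently (h.mono fun _ hε => Region.notMem_image hε))

/-- The complement is dense, which lets local constants at neighbouring points be compared. The
conclusion does not involve the ambient surface, so the plane is chosen. -/
theorem frequently_notMem_image (P : LinkProjection l) (z : ℂ) : ∃ᶠ z' in 𝓝 z, z' ∉ P.image := by
  by_cases hz : z ∈ P.image
  · by_cases hc : z ∈ P.crossings
    · obtain ⟨q, q', Q₁, Q₂, Q₃, Q₄, h⟩ := exists_crossingCorners .plane hc
      exact h.lies₁.frequently_notMem_image
    · obtain ⟨i, t, rfl⟩ := P.mem_image_iff.1 hz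
      obtain ⟨L, R, -, h⟩ := exists_arc_sides .plane hc
      exact h.self_of_nhds.1.frequently_notMem_image
  · exact Eventually.frequently (P.isClosed_image.isOpen_compl.mem_nhds hz)

/-- Only finitely many regions occur near a point. If a function on the regions has equal values on
the two sides of each arc, then it is constant on these regions. -/
theorem exists_finite_near (A : Ambient) (z : ℂ) : ∃ S : Set (P.Region A), S.Finite ∧
    (∀ᶠ z' in 𝓝 z, ∀ R : P.Region A, z' ∈ R.finitePart → R ∈ S) ∧
    ∀ f : P.Region A → ℤ, (∀ i t, P.curve i t ∉ P.crossings → ∀ L R : P.Region A,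
      IsSidePair L R i t → f L = f R) → ∃ c, ∀ R ∈ S, f R = c := by
  by_cases hz : z ∈ P.image
  · by_cases hc : z ∈ P.crossings
    · obtain ⟨q, q', Q₁, Q₂, Q₃, Q₄, h⟩ := exists_crossingCorners A hc
      refine ⟨{Q₁, Q₂, Q₃, Q₄}, by simp, ?_, fun f hf => ⟨f Q₁, ?_⟩⟩
      · filter_upwards [h.near] with z' hz' R hR
        rcases hz' (Region.notMem_image hR) with h' | h' | h' | h' <;>
          simp [Region.eq_of_mem hR h']
      · obtain ⟨s, hs, h1⟩ := h.exists_after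
        obtain ⟨s', hs', h2⟩ := h.exists_after'
        obtain ⟨s'', hs'', h3⟩ := h.exists_before
        have e1 := hf _ _ hs _ _ h1
        have e2 := hf _ _ hs' _ _ h2
        have e3 := hf _ _ hs'' _ _ h3
        rintro R (rfl | rfl | rfl | rfl)
        · rfl
        · exact e2
        · exact e3.symm.trans e2
        · exact e1.symm
    · obtain ⟨i, t, rfl⟩ := P.mem_image_iff.1 hz
      obtain ⟨L, R, hn, h⟩ := exists_arc_sides A hc
      refine ⟨{L, R}, by simp, ?_, fun f hf => ⟨f R, ?_⟩⟩
      · filter_upwards [hn] with z' hz' R' hR'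
        rcases hz' (Region.notMem_image hR') with h' | h' <;> simp [Region.eq_of_mem hR' h']
      · rintro R' (rfl | rfl)
        · exact hf _ _ hc _ _ h.self_of_nhds
        · rfl
  · obtain ⟨R, hR⟩ := Region.exists_mem (A := A) hz
    refine ⟨{R}, by simp, ?_, fun f _ => ⟨f R, by simp⟩⟩
    filter_upwards [R.isOpen_finitePart.mem_nhds hR] with z' hz' R' hR'
    exact Region.eq_of_mem hR' hz'

/-- Near every point of the plane, curves included, `f` takes a single value `c z`. By density of
the complement these values agree locally, and the plane is connected. -/
theorem eq_of_forall_isSidePair {f : P.Region A → ℤ}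
    (hf : ∀ i t, P.curve i t ∉ P.crossings → ∀ L R : P.Region A, IsSidePair L R i t → f L = f R)
    (R R' : P.Region A) : f R = f R' := by
  have hloc : ∀ z : ℂ, ∃ c, ∀ᶠ z' in 𝓝 z, ∀ R : P.Region A, z' ∈ R.finitePart → f R = c := by
    intro z
    obtain ⟨S, -, hS, hc⟩ := exists_finite_near (P := P) A z
    obtain ⟨c, hc⟩ := hc f hf
    exact ⟨c, hS.mono fun z' hz' R hR => hc R (hz' R hR)⟩
  choose c hc using hloc
  have hlc : IsLocallyConstant c := by
    rw [IsLocallyConstant.iff_eventually_eq]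
    intro z
    filter_upwards [eventually_eventually_nhds.2 (hc z)] with z' hz'
    obtain ⟨w, hw, h1, h2⟩ := ((P.frequently_notMem_image z').and_eventually
      (hz'.and (hc z'))).exists
    obtain ⟨S, hS⟩ := Region.exists_mem (A := A) hw
    exact (h2 S hS).symm.trans (h1 S hS)
  obtain ⟨z, hz⟩ := R.nonempty_finitePart
  obtain ⟨z', hz'⟩ := R'.nonempty_finitePart
  rw [(hc z).self_of_nhds R hz, (hc z').self_of_nhds R' hz']
  exact hlc.apply_eq_of_preconnectedSpace z z'

/-- Compactness handles the regions meeting a closed disc around the image; only one region reaches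
outside, because the exterior of the disc is connected. -/
theorem finite_region (P : LinkProjection l) (A : Ambient) : Finite (P.Region A) := by
  obtain ⟨r, hr⟩ := P.exists_image_norm_le
  choose S hS hn _ using exists_finite_near (P := P) A
  obtain ⟨T, hT, hcov⟩ := (isCompact_closedBall (0 : ℂ) (r + 1)).elim_nhds_subcover
    (fun z => {z' | ∀ R : P.Region A, z' ∈ R.finitePart → R ∈ S z}) (fun z _ => hn z)
  have hfin : (⋃ z ∈ T, S z).Finite := T.finite_toSet.biUnion fun z _ => hS z
  have hout : {R : P.Region A | ∃ z ∈ R.finitePart, r < ‖z‖}.Subsingleton := by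
    rintro R ⟨z, hz, hzr⟩ R' ⟨z', hz', hzr'⟩
    have := Region.subset_finitePart (isPreconnected_setOf_lt_norm r)
      (fun w hw hwi => (hr w hwi).not_gt hw) hz hzr
    exact Region.eq_of_mem (this hzr') hz'
  refine finite_univ_iff.1 ((hfin.union hout.finite).subset fun R _ => ?_)
  obtain ⟨z, hz⟩ := R.nonempty_finitePart
  by_cases hzr : r < ‖z‖
  · exact Or.inr ⟨z, hz, hzr⟩
  · left
    have hzb : z ∈ Metric.closedBall (0 : ℂ) (r + 1) := by
      rw [mem_closedBall_zero_iff]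
      linarith
    obtain ⟨w, hw, hzw⟩ := mem_iUnion₂.1 (hcov hzb)
    exact mem_biUnion hw (hzw R hz)

theorem IsSidePair.add_int {L R : P.Region A} {i : Fin l} {t : ℝ} (h : IsSidePair L R i t) (n : ℤ) :
    IsSidePair L R i (t + n) := by
  have h1 := P.curve_add_int i t n
  have h2 := (periodic_deriv (P.periodic i)).int_mul n t
  rw [mul_one] at h2
  rwa [IsSidePair, h1, h2]

/-- If the alternating sums around all crossings vanish, then the jump of a function on the regions
across an arc depends only on the component. -/
theorem exists_jump {f : P.Region A → ℤ}
    (hf : ∀ x q q' Q₁ Q₂ Q₃ Q₄, CrossingCorners (A := A) (P := P) x q q' Q₁ Q₂ Q₃ Q₄ →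
      f Q₁ - f Q₂ + f Q₃ - f Q₄ = 0) (i : Fin l) :
    ∃ c : ℤ, ∀ t, P.curve i t ∉ P.crossings → ∀ L R : P.Region A, IsSidePair L R i t →
      f L = f R + c := by
  have hside : ∀ {L R L' R' : P.Region A} {t : ℝ}, IsSidePair L R i t → IsSidePair L' R' i t →
      L = L' ∧ R = R' := fun h h' => ⟨h.1.eq h'.1, h.2.eq h'.2⟩
  have hcrossing : ∀ t, P.curve i t ∈ P.crossings → ∃ c : ℤ, ∀ᶠ s in 𝓝[≠] t,
      ∃ L R : P.Region A, IsSidePair L R i s ∧ f L = f R + c := by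
    intro t ht
    obtain ⟨q, q', Q₁, Q₂, Q₃, Q₄, h⟩ := exists_crossingCorners A ht
    have hsum := hf _ _ _ _ _ _ _ h
    have key : ∃ c : ℤ, ∃ (t' : ℝ) (n : ℤ), t = t' + n ∧ ∀ᶠ s in 𝓝[≠] t',
        ∃ L R : P.Region A, IsSidePair L R i s ∧ f L = f R + c := by
      have e := P.strandPoint_strandAt i t
      have hcase : strandAt i t = q ∨ strandAt i t = q' := by
        rcases P.double (strandAt i t) q q' (e.trans h.point.symm) (h.point.trans h.point'.symm)
          with h' | h' | h'
        · exact Or.inl h'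
        · exact absurd h' h.ne
        · exact Or.inr h'
      rcases hcase with h' | h'
      · rw [← strandAt_self q] at h'
        obtain ⟨rfl, n, hn⟩ := eq_add_int_of_strandAt_eq h'
        -- The vanishing sum reads `f Q₁ - f Q₄ = f Q₂ - f Q₃`: the jumps of this strand after and
        -- before the crossing agree. For the other strand it reads `f Q₂ - f Q₁ = f Q₃ - f Q₄`.
        refine ⟨f Q₁ - f Q₄, q.2, n, hn, ?_⟩
        rw [← nhdsLT_sup_nhdsGT, eventually_sup]
        exact ⟨h.before.mono fun s hs => ⟨Q₂, Q₃, hs, by omega⟩,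
          h.after.mono fun s hs => ⟨Q₁, Q₄, hs, by omega⟩⟩
      · rw [← strandAt_self q'] at h'
        obtain ⟨rfl, n, hn⟩ := eq_add_int_of_strandAt_eq h'
        refine ⟨f Q₂ - f Q₁, q'.2, n, hn, ?_⟩
        rw [← nhdsLT_sup_nhdsGT, eventually_sup]
        exact ⟨h.before'.mono fun s hs => ⟨Q₃, Q₄, hs, by omega⟩,
          h.after'.mono fun s hs => ⟨Q₂, Q₁, hs, by omega⟩⟩
    obtain ⟨c, t', n, rfl, hev⟩ := key
    refine ⟨c, ?_⟩
    have htend : Tendsto (fun s : ℝ => s - n) (𝓝[≠] (t' + n)) (𝓝[≠] t') := by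
      refine tendsto_nhdsWithin_of_tendsto_nhds_of_eventually_within _ ?_ ?_
      · have : Continuous fun s : ℝ => s - n := by fun_prop
        simpa using (this.tendsto (t' + n)).mono_left nhdsWithin_le_nhds
      · filter_upwards [self_mem_nhdsWithin] with s hs hs'
        exact hs (by simpa using congrArg (· + (n : ℝ)) hs')
    filter_upwards [htend.eventually hev] with s hs
    obtain ⟨L, R, hLR, e⟩ := hs
    refine ⟨L, R, ?_, e⟩
    have := hLR.add_int n
    rwa [sub_add_cancel] at this
  -- Punctured neighbourhoods are used so that arcs and crossings are treated alike: the jump is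
  -- compared only at parameters beside `t`.
  have hloc : ∀ t, ∃ c : ℤ, ∀ᶠ s in 𝓝[≠] t,
      ∃ L R : P.Region A, IsSidePair L R i s ∧ f L = f R + c := by
    intro t
    by_cases ht : P.curve i t ∈ P.crossings
    · exact hcrossing t ht
    · obtain ⟨L, R, -, h⟩ := exists_arc_sides A ht
      exact ⟨f L - f R, nhdsWithin_le_nhds (h.mono fun s hs => ⟨L, R, hs, by ring⟩)⟩
  choose c hc using hloc
  have hlc : IsLocallyConstant c := by
    rw [IsLocallyConstant.iff_eventually_eq]
    intro t
    have h1 := eventually_eventually_nhdsWithin.2 (hc t)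
    rw [eventually_nhdsWithin_iff] at h1
    filter_upwards [h1] with s hs
    rcases eq_or_ne s t with rfl | hst
    · rfl
    have h2 := hs hst
    rw [isOpen_compl_singleton.nhdsWithin_eq hst] at h2
    replace h2 := h2.filter_mono (nhdsWithin_le_nhds (s := {s}ᶜ))
    obtain ⟨u, ⟨L, R, hLR, e⟩, L', R', hLR', e'⟩ := (h2.and (hc s)).exists
    obtain ⟨rfl, rfl⟩ := hside hLR hLR'
    omega
  refine ⟨c 0, fun t ht L R hLR => ?_⟩
  obtain ⟨L', R', -, h⟩ := exists_arc_sides A ht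
  obtain ⟨rfl, rfl⟩ := hside hLR h.self_of_nhds
  obtain ⟨s, hs, L', R', hs', e⟩ :=
    ((h.filter_mono (nhdsWithin_le_nhds (s := {t}ᶜ))).and (hc t)).exists
  obtain ⟨rfl, rfl⟩ := hside hs hs'
  rw [e, hlc.apply_eq_of_preconnectedSpace t 0]

/-! ### Alexander numberings and checkerboard colorings from winding numbers. -/

theorem isAlexanderNumbering_sum_winding (P : LinkProjection l) (A : Ambient) :
    IsAlexanderNumbering (fun R : P.Region A => ∑ j, R.winding j) := by
  intro q hq L R hL hR
  have h : ∀ j, L.winding j = R.winding j + if j = q.1 then 1 else 0 :=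
    IsSidePair.winding_eq (t := q.2) ⟨hL, hR⟩ hq
  simp [h, Finset.sum_add_distrib]

theorem exists_side_pair (P : LinkProjection l) (A : Ambient) (i : Fin l) :
    ∃ t, P.curve i t ∉ P.crossings ∧ ∃ L R : P.Region A, IsSidePair L R i t := by
  obtain ⟨t, ht⟩ := (P.eventually_curve_notMem_crossings i 0).exists
  obtain ⟨L, R, -, h⟩ := exists_arc_sides A ht
  exact ⟨t, ht, L, R, h.self_of_nhds⟩

theorem component_complement_subset (i : Fin l) :
    P.complement A ⊆ (P.component i).complement A := by
  refine sdiff_subset_sdiff_right (image_mono ?_)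
  intro z hz
  obtain ⟨_, t, rfl⟩ := (P.component i).mem_image_iff.1 hz
  exact P.mem_image_curve i t

theorem exists_component_region (R : P.Region A) (i : Fin l) :
    ∃ S : (P.component i).Region A, R.1 ⊆ S.1 := by
  obtain ⟨R, x, hx, rfl⟩ := R
  exact ⟨⟨_, x, component_complement_subset i hx, rfl⟩,
    connectedComponentIn_mono x (component_complement_subset i)⟩

theorem winding_component {R : P.Region A} {i : Fin l} {S : (P.component i).Region A}
    (h : R.1 ⊆ S.1) (j : Fin 1) : S.winding j = R.winding i := by
  obtain ⟨z, hz⟩ := R.nonempty_finitePart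
  rw [Region.winding_eq hz i, Region.winding_eq (show z ∈ S.finitePart from h hz) j]
  rfl

/-- An Alexander numbering of the component minus its winding number has no jumps, hence is
constant; the value at `Rinf` fixes the constant. Existence and uniqueness both follow. -/
theorem isStandardKernelSolution_iff (Rinf : P.Region A) (i : Fin l) (u : P.Region A → ℤ) :
    IsStandardKernelSolution Rinf i u ↔ u = fun R => R.winding i - Rinf.winding i := by
  constructor
  · rintro ⟨⟨a, ha, hau⟩, h0⟩
    have hconst : ∀ S S' : (P.component i).Region A, a S - S.winding 0 = a S' - S'.winding 0 := by
      refine eq_of_forall_isSidePair fun j t ht L R h => ?_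
      rw [ha.eq_add_one ht h, h.winding_eq ht 0, if_pos (Subsingleton.elim _ _)]
      ring
    funext R
    obtain ⟨S, hS⟩ := exists_component_region R i
    obtain ⟨S', hS'⟩ := exists_component_region Rinf i
    have h1 := hconst S S'
    rw [← hau R S hS, ← hau Rinf S' hS', h0, winding_component hS, winding_component hS'] at h1
    omega
  · rintro rfl
    refine ⟨⟨fun S => S.winding 0 - Rinf.winding i, ?_, fun R S h => ?_⟩, sub_self _⟩
    · intro q hq L R hL hR
      have h := IsSidePair.winding_eq (t := q.2) ⟨hL, hR⟩ hq 0
      rw [if_pos (Subsingleton.elim _ _)] at h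
      simp only [h]
      ring
    · simp only [winding_component h]

theorem exists_isCheckerboardColoring (P : LinkProjection l) (A : Ambient) :
    ∃ c : P.Region A → ZMod 2, IsCheckerboardColoring c :=
  ⟨_, _, P.isAlexanderNumbering_sum_winding A, fun _ => rfl⟩

/-! ### Matrix entries as corner counts. -/

section Corners

variable {x : P.crossings} {q q' : Strand l} {Q₁ Q₂ Q₃ Q₄ : P.Region A}

/-- `Q₄` is on the right of both strands, `Q₂` on the left of both, and `Q₁`, `Q₃` are on the left
of exactly one. -/
theorem CrossingCorners.alexander {z : ℂ} (h : CrossingCorners z q q' Q₁ Q₂ Q₃ Q₄)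
    {a : P.Region A → ℤ} (ha : IsAlexanderNumbering a) :
    a Q₁ = a Q₄ + 1 ∧ a Q₂ = a Q₄ + 2 ∧ a Q₃ = a Q₄ + 1 := by
  obtain ⟨s, hs, h1⟩ := h.exists_after
  obtain ⟨s', hs', h2⟩ := h.exists_after'
  obtain ⟨s'', hs'', h3⟩ := h.exists_before'
  have e1 := ha.eq_add_one hs h1
  have e2 := ha.eq_add_one hs' h2
  have e3 := ha.eq_add_one hs'' h3
  omega

theorem CrossingCorners.ne_of_adjacent {z : ℂ} (h : CrossingCorners z q q' Q₁ Q₂ Q₃ Q₄) :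
    Q₁ ≠ Q₂ ∧ Q₁ ≠ Q₄ ∧ Q₂ ≠ Q₃ ∧ Q₃ ≠ Q₄ ∧ Q₂ ≠ Q₄ := by
  obtain ⟨a, ha⟩ : ∃ a : P.Region A → ℤ, IsAlexanderNumbering a :=
    ⟨_, P.isAlexanderNumbering_sum_winding A⟩
  obtain ⟨h1, h2, h3⟩ := h.alexander ha
  refine ⟨?_, ?_, ?_, ?_, ?_⟩ <;> intro e <;> have := congrArg a e <;> omega

theorem Region.LiesAt.mem_closure {R : P.Region A} {z w : ℂ} (h : R.LiesAt z w) :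
    z ∈ closure R.finitePart :=
  mem_closure_of_tendsto (tendsto_add_mul_nhdsGT z w) h

theorem CrossingCorners.mem_frontier_iff {z : ℂ} (h : CrossingCorners z q q' Q₁ Q₂ Q₃ Q₄)
    (R : P.Region A) :
    z ∈ frontier R.finitePart ↔ R = Q₁ ∨ R = Q₂ ∨ R = Q₃ ∨ R = Q₄ := by
  have hz : z ∈ P.image := h.point ▸ P.mem_image_curve q.1 q.2
  rw [R.isOpen_finitePart.frontier_eq]
  constructor
  · rintro ⟨hc, -⟩
    obtain ⟨w, hw, hn⟩ := ((mem_closure_iff_frequently.1 hc).and_eventually h.near).exists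
    rcases hn (Region.notMem_image hw) with h' | h' | h' | h' <;> simp [Region.eq_of_mem hw h']
  · rintro (rfl | rfl | rfl | rfl)
    · exact ⟨h.lies₁.mem_closure, fun h' => Region.notMem_image h' hz⟩
    · exact ⟨h.lies₂.mem_closure, fun h' => Region.notMem_image h' hz⟩
    · exact ⟨h.lies₃.mem_closure, fun h' => Region.notMem_image h' hz⟩
    · exact ⟨h.lies₄.mem_closure, fun h' => Region.notMem_image h' hz⟩

theorem CrossingCorners.mem_cornerDirections_iff (h : CrossingCorners (x : ℂ) q q' Q₁ Q₂ Q₃ Q₄)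
    (w : ℂ) : w ∈ P.cornerDirections x ↔
      w = strandTangent P.curve q + strandTangent P.curve q' ∨
      w = -strandTangent P.curve q + strandTangent P.curve q' ∨
      w = -strandTangent P.curve q + -strandTangent P.curve q' ∨
      w = strandTangent P.curve q + -strandTangent P.curve q' := by
  constructor
  · rintro ⟨r, r', hne, hr, hr', s, hs, s', hs', rfl⟩
    have hcase : ∀ y, strandPoint P.curve y = x → y = q ∨ y = q' := by
      intro y hy
      rcases P.double y q q' (hy.trans h.point.symm) (h.point.trans h.point'.symm)
        with h' | h' | h'
      · exact Or.inl h'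
      · exact absurd h' h.ne
      · exact Or.inr h'
    rcases hcase r hr with rfl | rfl <;> rcases hcase r' hr' with rfl | rfl
    · exact absurd rfl hne
    · rcases hs with rfl | rfl <;> rcases hs' with rfl | rfl <;> simp
    · rcases hs with rfl | rfl <;> rcases hs' with rfl | rfl <;> simp [add_comm]
    · exact absurd rfl hne
  · rintro (rfl | rfl | rfl | rfl)
    · exact ⟨q, q', h.ne, h.point, h.point', 1, by simp, 1, by simp, by simp⟩
    · exact ⟨q, q', h.ne, h.point, h.point', -1, by simp, 1, by simp, by simp⟩
    · exact ⟨q, q', h.ne, h.point, h.point', -1, by simp, -1, by simp, by simp⟩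
    · exact ⟨q, q', h.ne, h.point, h.point', 1, by simp, -1, by simp, by simp⟩

theorem CrossingCorners.touchesTwice_iff (h : CrossingCorners (x : ℂ) q q' Q₁ Q₂ Q₃ Q₄)
    (R : P.Region A) : R.TouchesTwice x ↔ R = Q₁ ∧ R = Q₃ := by
  obtain ⟨h12, h14, h23, h34, h24⟩ := h.ne_of_adjacent
  constructor
  · have key : ∀ w ∈ P.cornerDirections x, R.LiesAt x w →
        (w = strandTangent P.curve q + strandTangent P.curve q' ∧ R = Q₁) ∨
        (w = -strandTangent P.curve q + strandTangent P.curve q' ∧ R = Q₂) ∨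
        (w = -strandTangent P.curve q + -strandTangent P.curve q' ∧ R = Q₃) ∨
        (w = strandTangent P.curve q + -strandTangent P.curve q' ∧ R = Q₄) := by
      intro w hw hl
      rcases (h.mem_cornerDirections_iff w).1 hw with rfl | rfl | rfl | rfl
      · exact Or.inl ⟨rfl, hl.eq h.lies₁⟩
      · exact Or.inr (Or.inl ⟨rfl, hl.eq h.lies₂⟩)
      · exact Or.inr (Or.inr (Or.inl ⟨rfl, hl.eq h.lies₃⟩))
      · exact Or.inr (Or.inr (Or.inr ⟨rfl, hl.eq h.lies₄⟩))
    rintro ⟨w, hw, w', hw', hne, hl, hl'⟩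
    have h1 := key w hw hl
    have h2 := key w' hw' hl'
    grind
  · rintro ⟨rfl, h13⟩
    refine ⟨_, (h.mem_cornerDirections_iff _).2 (Or.inl rfl), _,
      (h.mem_cornerDirections_iff _).2 (Or.inr (Or.inr (Or.inl rfl))), ?_, h.lies₁, ?_⟩
    · intro e
      -- Opposite corner directions could coincide only if the velocities were antiparallel, which
      -- transversality excludes.
      have e' : strandTangent P.curve q' = -strandTangent P.curve q := by linear_combination e / 2
      have := h.det_pos
      rw [e', planeDet_neg_right, planeDet_self, neg_zero] at this
      exact lt_irrefl _ this
    · rw [h13]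
      exact h.lies₃

open Classical in
-- By their Alexander numbers, only `Q₁` and `Q₃` can be the same region, and this is exactly the
-- case of entry `2`.
theorem CrossingCorners.matrixD2_eq (h : CrossingCorners (x : ℂ) q q' Q₁ Q₂ Q₃ Q₄)
    (R : P.Region A) : P.matrixD2 A x R =
      (if R = Q₁ then 1 else 0) + (if R = Q₂ then 1 else 0) + (if R = Q₃ then 1 else 0) +
        (if R = Q₄ then 1 else 0) := by
  obtain ⟨h12, h14, h23, h34, h24⟩ := h.ne_of_adjacent
  simp only [matrixD2, matrixD1, h.touchesTwice_iff, h.mem_frontier_iff]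
  by_cases e1 : R = Q₁
  · subst e1
    by_cases e3 : R = Q₃ <;> simp [e3, h12, h14, h34, h23.symm]
  · by_cases e2 : R = Q₂
    · subst e2
      simp [e1, h23, h24]
    · by_cases e3 : R = Q₃
      · subst e3
        simp [e1, e2, h34]
      · simp [e1, e2, e3]

theorem CrossingCorners.mapD2_eq (h : CrossingCorners (x : ℂ) q q' Q₁ Q₂ Q₃ Q₄)
    (u : P.Region A → ℤ) : P.mapD2 A u x = u Q₁ + u Q₂ + u Q₃ + u Q₄ := by
  classical
  have := P.finite_region A
  have := Fintype.ofFinite (P.Region A)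
  simp [mapD2, finsum_eq_sum_of_fintype, h.matrixD2_eq, add_mul, Finset.sum_add_distrib]

end Corners

/-! ### The sign twist, the kernel and its basis. -/

theorem IsCheckerboardColoring.sign_eq {c : P.Region A → ZMod 2} (hc : IsCheckerboardColoring c) :
    ∃ a : P.Region A → ℤ, IsAlexanderNumbering a ∧
      ∀ R, ((-1) ^ (c R).val : ℤ) = if Even (a R) then 1 else -1 := by
  obtain ⟨a, ha, hca⟩ := hc
  refine ⟨a, ha, fun R => ?_⟩
  rw [hca]
  split_ifs with h
  · rw [(ZMod.intCast_eq_zero_iff_even).2 h]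
    simp
  · rw [(ZMod.intCast_eq_one_iff_odd).2 (Int.not_even_iff_odd.1 h)]
    simp [ZMod.val_one]

theorem signTwist_signTwist (c : P.Region A → ZMod 2) (u : P.Region A → ℤ) :
    signTwist c (signTwist c u) = u := by
  funext R
  simp only [signTwist]
  rw [← mul_assoc, ← mul_pow]
  simp

/-- The signs at `Q₂` and `Q₄` agree and are opposite to those at `Q₁` and `Q₃`, so the two sums are
equal up to a global sign. -/
theorem signTwist_corner_sum_eq_zero_iff {c : P.Region A → ZMod 2} (hc : IsCheckerboardColoring c)
    {z : ℂ} {q q' : Strand l} {Q₁ Q₂ Q₃ Q₄ : P.Region A}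
    (h : CrossingCorners z q q' Q₁ Q₂ Q₃ Q₄) (f : P.Region A → ℤ) :
    signTwist c f Q₁ + signTwist c f Q₂ + signTwist c f Q₃ + signTwist c f Q₄ = 0 ↔
      f Q₁ - f Q₂ + f Q₃ - f Q₄ = 0 := by
  obtain ⟨a, ha, hs⟩ := hc.sign_eq
  obtain ⟨h1, h2, h3⟩ := h.alexander ha
  have p1 : Even (a Q₄ + 1) ↔ ¬Even (a Q₄) := Int.even_add_one
  have p2 : Even (a Q₄ + 2) ↔ Even (a Q₄) := by simp
  simp only [signTwist, hs, h1, h2, h3, p1, p2]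
  by_cases he : Even (a Q₄) <;>
    simp only [he, not_true_eq_false, not_false_eq_true, if_true, if_false] <;> omega

theorem ker_mapD2_iff {c : P.Region A → ZMod 2} (hc : IsCheckerboardColoring c)
    (f : P.Region A → ℤ) :
    P.mapD2 A (signTwist c f) = 0 ↔ ∀ x q q' Q₁ Q₂ Q₃ Q₄,
      CrossingCorners (A := A) (P := P) x q q' Q₁ Q₂ Q₃ Q₄ → f Q₁ - f Q₂ + f Q₃ - f Q₄ = 0 := by
  constructor
  · intro h0 x q q' Q₁ Q₂ Q₃ Q₄ h
    have hx : x ∈ P.crossings := ⟨q, q', h.ne, h.point, h.point'⟩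
    rw [← signTwist_corner_sum_eq_zero_iff hc h, ← h.mapD2_eq (x := ⟨x, hx⟩), h0]
    rfl
  · intro h0
    funext x
    obtain ⟨q, q', Q₁, Q₂, Q₃, Q₄, h⟩ := exists_crossingCorners A x.2
    rw [h.mapD2_eq, Pi.zero_apply, signTwist_corner_sum_eq_zero_iff hc h]
    exact h0 _ _ _ _ _ _ _ h

theorem CrossingCorners.alternating_sum_winding {z : ℂ} {q q' : Strand l}
    {Q₁ Q₂ Q₃ Q₄ : P.Region A} (h : CrossingCorners z q q' Q₁ Q₂ Q₃ Q₄) (j : Fin l) :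
    Q₁.winding j - Q₂.winding j + Q₃.winding j - Q₄.winding j = 0 := by
  obtain ⟨s, hs, h1⟩ := h.exists_after
  obtain ⟨s', hs', h2⟩ := h.exists_before
  have e1 := h1.winding_eq hs j
  have e2 := h2.winding_eq hs' j
  omega

/-- The jump across the `i`-th component reads off the coefficient `g i`; independence and
generation both rest on this. -/
theorem IsSidePair.sum_mul_winding {L R : P.Region A} {i : Fin l} {t : ℝ} (h : IsSidePair L R i t)
    (ht : P.curve i t ∉ P.crossings) (Rinf : P.Region A) (g : Fin l → ℤ) :
    ∑ j, g j * (L.winding j - Rinf.winding j) =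
      ∑ j, g j * (R.winding j - Rinf.winding j) + g i := by
  have h' := h.winding_eq ht
  simp only [h', mul_sub, mul_add, Finset.sum_sub_distrib, Finset.sum_add_distrib]
  simp only [mul_ite, mul_one, mul_zero, Finset.sum_ite_eq', Finset.mem_univ, if_true]
  ring

theorem exists_basis_ker {Φ : (P.Region A → ℤ) →ₗ[ℤ] (P.crossings → ℤ)}
    (hΦ : ∀ u, Φ u = P.mapD2 A u) (Rinf : P.Region A) {c : P.Region A → ZMod 2}
    (hc : IsCheckerboardColoring c) :
    ∃ b : Module.Basis (Option (Fin l)) ℤ (LinearMap.ker Φ), ∀ k, (b k : P.Region A → ℤ) =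
      signTwist c (withInfinity (fun i R => R.winding i - Rinf.winding i) k) := by
  set u : Fin l → P.Region A → ℤ := fun i R => R.winding i - Rinf.winding i with hu
  have hker : ∀ k, signTwist c (withInfinity u k) ∈ LinearMap.ker Φ := by
    intro k
    rw [LinearMap.mem_ker, hΦ, ker_mapD2_iff hc]
    intro x q q' Q₁ Q₂ Q₃ Q₄ h
    cases k with
    | none => simp [withInfinity]
    | some i =>
      have := h.alternating_sum_winding i
      simp only [withInfinity, hu]
      omega
  set v : Option (Fin l) → LinearMap.ker Φ := fun k => ⟨_, hker k⟩ with hv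
  have hsum : ∀ (g : Option (Fin l) → ℤ) (R : P.Region A),
      ((∑ k, g k • v k : LinearMap.ker Φ) : P.Region A → ℤ) R =
        (-1) ^ (c R).val * (g none + ∑ i, g (some i) * (R.winding i - Rinf.winding i)) := by
    intro g R
    rw [AddSubmonoidClass.coe_finsetSum, Finset.sum_apply, Fintype.sum_option, mul_add,
      Finset.mul_sum]
    simp only [hv, Submodule.coe_smul, Pi.smul_apply, smul_eq_mul, signTwist, withInfinity, hu]
    congr 1
    · ring
    · exact Finset.sum_congr rfl fun i _ => by ring
  have hli : LinearIndependent ℤ v := by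
    rw [Fintype.linearIndependent_iff]
    intro g hg
    have h0 : ∀ R : P.Region A,
        g none + ∑ i, g (some i) * (R.winding i - Rinf.winding i) = 0 := by
      intro R
      have := hsum g R
      rw [hg] at this
      exact (mul_eq_zero.1 this.symm).resolve_left (pow_ne_zero _ (by norm_num))
    have hsome : ∀ i, g (some i) = 0 := by
      intro i
      obtain ⟨t, ht, L, R, h⟩ := P.exists_side_pair A i
      have e := h.sum_mul_winding ht Rinf fun j => g (some j)
      have e1 := h0 L
      have e2 := h0 R
      omega
    intro k
    cases k with
    -- With the other coefficients zero, only the constant term is left.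
    | none => simpa [hsome] using h0 Rinf
    | some i => exact hsome i
  have hsp : ⊤ ≤ Submodule.span ℤ (range v) := by
    rintro ⟨w, hw⟩ -
    rw [LinearMap.mem_ker, hΦ, ← signTwist_signTwist c w, ker_mapD2_iff hc] at hw
    choose d hd using exists_jump hw
    have hconst := eq_of_forall_isSidePair (P := P) (A := A)
      (f := fun R => signTwist c w R - ∑ j, d j * (R.winding j - Rinf.winding j))
      (fun i t ht L R h => by
        have e1 := hd i t ht L R h
        have e2 := h.sum_mul_winding ht Rinf d
        simp only [e1, e2]
        ring)
    rw [Submodule.mem_span_range_iff_exists_fun]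
    -- The coefficients are the jumps `d` and, for the constant vector, the value at `Rinf`, where
    -- all normalised winding numbers vanish. Twisting is an involution, so twisting back recovers
    -- `w`.
    refine ⟨fun k => k.elim (signTwist c w Rinf) d, Subtype.ext (funext fun R => ?_)⟩
    rw [hsum]
    have e := hconst R Rinf
    simp only [sub_self, mul_zero, Finset.sum_const_zero, sub_zero] at e
    have e' : signTwist c w R =
        signTwist c w Rinf + ∑ j, d j * (R.winding j - Rinf.winding j) := by omega
    have e'' := congrFun (signTwist_signTwist c w) R
    rw [signTwist, e'] at e''
    exact e''
  exact ⟨Module.Basis.mk hli hsp, fun k => by rw [Module.Basis.mk_apply]⟩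

end LinkProjection

end

theorem mainTheorem5 {l : ℕ} (A : Ambient) (D : LinkDiagram l)
    (hD : D.crossings.Nonempty)
    (Rinf : D.toLinkProjection.Region A) (hRinf : LinkProjection.IsRegionAtInfinity Rinf) :
    Finite (D.toLinkProjection.Region A) ∧
    (∀ i : Fin l, ∃! u : D.toLinkProjection.Region A → ℤ,
      LinkProjection.IsStandardKernelSolution Rinf i u) ∧
    (∃ c : D.toLinkProjection.Region A → ZMod 2, LinkProjection.IsCheckerboardColoring c) ∧
    ∃ Φ : (D.toLinkProjection.Region A → ℤ) →ₗ[ℤ] (D.crossings → ℤ),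
      (∀ u, Φ u = D.mapD2 A u) ∧
      ∀ (u : Fin l → D.toLinkProjection.Region A → ℤ)
        (c : D.toLinkProjection.Region A → ZMod 2),
        (∀ i, LinkProjection.IsStandardKernelSolution Rinf i (u i)) →
        LinkProjection.IsCheckerboardColoring c →
        ∃ b : Module.Basis (Option (Fin l)) ℤ (LinearMap.ker Φ),
          ∀ k, (b k : D.toLinkProjection.Region A → ℤ) =
            LinkProjection.signTwist c (LinkProjection.withInfinity u k) := by
  have hfin := D.finite_region A
  have := Fintype.ofFinite (D.toLinkProjection.Region A)
  -- Finiteness of the set of regions turns the `finsum` into an ordinary matrix product, which is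
  -- linear.
  have hΦ : ∀ u, (D.matrixD2 A).mulVecLin u = D.mapD2 A u := fun u =>
    funext fun x => (finsum_eq_sum_of_fintype _).symm
  refine ⟨hfin, fun i => ?_, D.exists_isCheckerboardColoring A, (D.matrixD2 A).mulVecLin, hΦ,
    fun u c hu hc => ?_⟩
  · simp only [LinkProjection.isStandardKernelSolution_iff]
    exact existsUnique_eq
  · obtain rfl : u = fun i R => R.winding i - Rinf.winding i :=
      funext fun i => (LinkProjection.isStandardKernelSolution_iff Rinf i (u i)).1 (hu i)
    exact LinkProjection.exists_basis_ker hΦ Rinf hc
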